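/- Let $\alpha\in[0,1)$, $T>0$, let $k\ge 4$ be an integer, and let $f_0\in H^k(\mathbb R^2)$ be real-valued, where $\|g\|_{H^k}^2=\|g\|_{L^2}^2+\|(-\Delta)^{k/2}g\|_{L^2}^2$. A solution on $[0,T]$ with initial datum $f_0$ of the generalised $\alpha$-Muskat contour equation is a real-valued $f\in C^1([0,T];H^k(\mathbb R^2))$, each $f(\cdot,t)$ being identified with its continuous representative, such that $f(\cdot,0)=f_0$ and, for all $x\in\mathbb R^2$ and $t\in[0,T]$, $$\partial_t f(x,t)=\mathrm{PV}\int_{\mathbb R^2}\frac{\bigl(\nabla f(x,t)-\nabla f(x-y,t)\bigr)\cdot y}{\bigl[|y|^2+(f(x,t)-f(x-y,t))^2\bigr]^{\frac{3+\alpha}{2}}}\,dy ,$$ where $\mathrm{PV}\int_{\mathbb R^2}$ is the limit of $\int_{\delta<|y|<R}$ as $\delta\to0^+$, $R\to\infty$ (and $\partial_t$ is one-sided at the endpoints of $[0,T]$). The norms $\|\nabla f(t)\|_{L^p}$ are the $L^p(\mathbb R^2)$ norms of the Euclidean length $|\nabla f(\cdot,t)|$. Theorem. There is a function $C_\#=C_\#(a,b,M,\varepsilon,\alpha)$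 with positive values such that the following holds for all $\alpha\in[0,1)$, $\varepsilon\in(0,1+\alpha)$, $T>0$, $M_T>0$, $k\ge4$ and $f_0\in H^k(\mathbb R^2)$. If $f$ is the solution on $[0,T]$ with initial datum $f_0$, if $$\|\nabla f_0\|_{L^\infty}<\sqrt{\frac{1+\alpha-\varepsilon}{5+\alpha+\varepsilon}},$$ and if $\sup_{t\in[0,T]}\|\nabla f(t)\|_{L^1}\le M_T$, then for all $t\in[0,T]$ $$\|\nabla f(t)\|_{L^\infty}\le\frac{\|\nabla f_0\|_{L^\infty}}{\bigl[1+C_\#\bigl(\|f_0\|_{L^\infty},\|\nabla f_0\|_{L^\infty},M_T,\varepsilon,\alpha\bigr)\,t\bigr]^{\frac{2}{1+\alpha}}}.$$ -/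

import Mathlib

open MeasureTheory Filter Set
open scoped Topology ENNReal FourierTransform Gradient

noncomputable section

namespace AlphaMuskat

/-- The Euclidean plane. -/
abbrev Plane : Type := EuclideanSpace ℝ (Fin 2)

/-! ### The Sobolev spaces `H^k` and curves of class `C^1` in them -/

open Classical in
/-- The (Plancherel) Fourier transform of a real function in `L²` of the plane; the value is `0` for
functions that are not in `L²`. The convention is `f̂(ξ) = ∫ exp(-2πi x·ξ) f(x) dx`. -/
def fourierL2 (f : Plane → ℝ) : Plane → ℂ :=
  if h : MemLp (fun x => (f x : ℂ)) 2 volume then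
    ((𝓕 (h.toLp (fun x => (f x : ℂ))) : Lp ℂ 2 (volume : Measure Plane)) : Plane → ℂ)
  else 0

/-- The norm `‖f‖_{H^k} = (‖f‖²_{L²} + ‖Λ^k f‖²_{L²})^{1/2}` with `Λ = (-Δ)^{1/2}`, of a function
`f` in `L²`, written on the Fourier side, where `Λ` has the symbol `2π|ξ|`. It may be infinite. -/
def sobolevNorm (k : ℕ) (f : Plane → ℝ) : ℝ≥0∞ :=
  (∫⁻ ξ, ENNReal.ofReal (1 + (2 * Real.pi * ‖ξ‖) ^ (2 * k)) * ‖fourierL2 f ξ‖ₑ ^ 2) ^ (1 / 2 : ℝ)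

/-- Membership in `H^k` of the plane. -/
def MemH (k : ℕ) (f : Plane → ℝ) : Prop :=
  MemLp f 2 volume ∧ sobolevNorm k f < ∞

/-- `f ∈ C^1([0,T]; H^k)`: there is a continuous curve `f'` in `H^k` which is the derivative of the
curve `f` for the norm of `H^k`, one-sided at the endpoints. -/
def IsC1Curve (k : ℕ) (T : ℝ) (f : ℝ → Plane → ℝ) : Prop :=
  (∀ t ∈ Icc 0 T, MemH k (f t)) ∧
  ∃ f' : ℝ → Plane → ℝ,
    (∀ t ∈ Icc 0 T, MemH k (f' t)) ∧
    (∀ t ∈ Icc 0 T,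
      Tendsto (fun s => sobolevNorm k (fun x => (s - t)⁻¹ * (f s x - f t x) - f' t x))
        (𝓝[Icc 0 T \ {t}] t) (𝓝 0)) ∧
    (∀ t ∈ Icc 0 T,
      Tendsto (fun s => sobolevNorm k (fun x => f' s x - f' t x)) (𝓝[Icc 0 T] t) (𝓝 0))

/-! ### The contour equation -/

/-- The principal value of `∫ F(y) dy` over the plane, with singular points `0` and `∞`, exists and
equals `v`: it is the limit of the integrals over `δ < |y| < R` as `δ → 0⁺` and `R → ∞`. -/
def HasPrincipalValue (F : Plane → ℝ) (v : ℝ) : Prop :=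
  (∀ δ R : ℝ, 0 < δ → IntegrableOn F {y | δ < ‖y‖ ∧ ‖y‖ < R} volume) ∧
  Tendsto (fun p : ℝ × ℝ => ∫ y in {y : Plane | p.1 < ‖y‖ ∧ ‖y‖ < p.2}, F y)
    (𝓝[>] (0 : ℝ) ×ˢ atTop) (𝓝 v)

/-- The integrand
`(∇g(x) - ∇g(x-y))·y / [|y|² + (g(x) - g(x-y))²]^{(3+α)/2}` of the contour equation. -/
def contourIntegrand (α : ℝ) (g : Plane → ℝ) (x y : Plane) : ℝ :=
  inner ℝ (∇ g x - ∇ g (x - y)) y /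
    (‖y‖ ^ 2 + (g x - g (x - y)) ^ 2) ^ ((3 + α) / 2)

/-- `f` is a solution in `C^1([0,T]; H^k)` of the contour equation of the generalised Muskat problem
(with `(ρ₂ - ρ₁)/(4π) = 1`) with initial interface `f₀`. The value `f t` is the continuous
representative of its class, so that the equation makes sense at every point. -/
structure IsSolution (k : ℕ) (α T : ℝ) (f₀ : Plane → ℝ) (f : ℝ → Plane → ℝ) : Prop where
  isC1Curve : IsC1Curve k T f
  continuous : ∀ t ∈ Icc 0 T, Continuous (f t)
  equation : ∀ t ∈ Icc 0 T, ∀ x : Plane, ∃ v : ℝ,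
    HasPrincipalValue (contourIntegrand α (f t) x) v ∧
    HasDerivWithinAt (fun s => f s x) v (Icc 0 T) t
  initial : f 0 = f₀

end AlphaMuskat

end

/-!
The slope obeys a maximum principle. For fixed `w`, consider a point `x` where the increment
`f(x+w) - f(x)` is maximal. There the gradients at `x + w` and `x` agree, and on each ray `rσ` the
integrand depends only on the slope `u(r) = (f(x) - f(x - rσ)) / r`. Integrating by parts in `r`
turns it into a kernel which is decreasing in `u` while `|u|` stays below the threshold, with a
margin proportional to `ε`. Since the slopes at `x + w` dominate those at `x`, the increment
decreases at a rate at least `ε/8 ∫ |y|^{-3-α} (D(x) - D(x-y)) dy`, where `D(z) = f(z+w) - f(z)`.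
The `L¹` norm of `D` is at most `|w| M`, so integrating over `|y| ≤ R` only and choosing the best
scale of `R` makes this at least `|w| c S^{(3+α)/2}`, where `S = D(x)/|w|`. Comparison with
`B' = -c B^{(3+α)/2}` bounds all difference quotients, and as the barrier `B` decreases, a
continuity argument shows that the threshold is never reached.
-/

open scoped fwdDiff

namespace AlphaMuskat

section Fourier

variable {E : Type*} [NormedAddCommGroup E] [InnerProductSpace ℝ E] [FiniteDimensional ℝ E]
  [MeasurableSpace E] [BorelSpace E]

theorem integral_fourierInv_smul_eq {φ F : E → ℂ} (hφ : Integrable φ) (hF : Integrable F) :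
    ∫ x, 𝓕⁻ φ x • F x = ∫ x, φ x • 𝓕⁻ F x := by
  have hflip := VectorFourier.integral_fourierIntegral_smul_eq_flip (L := innerₗ E)
    Real.continuous_fourierChar continuous_inner hφ hF.comp_neg
  calc ∫ x, 𝓕⁻ φ x • F x = ∫ x, 𝓕 φ x • F (-x) := by
        rw [← integral_neg_eq_self]
        simp only [Real.fourierInv_eq_fourier_neg, neg_neg]
    _ = ∫ x, φ x • 𝓕⁻ F x := by
        rw [Real.fourierInv_eq_fourier_comp_neg]
        simpa using! hflip

theorem Lp_apply_eq_fourier_apply_fourierInv (f : Lp ℂ 2 (volume : Measure E))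
    (φ : SchwartzMap E ℂ) :
    ∫ x, φ x • f x = ∫ x, 𝓕⁻ (φ : E → ℂ) x • (𝓕 f : Lp ℂ 2 (volume : Measure E)) x := by
  have h : (f : TemperedDistribution E ℂ) φ
      = ((𝓕 f : Lp ℂ 2 (volume : Measure E)) : TemperedDistribution E ℂ) (𝓕⁻ φ) := by
    rw [← TemperedDistribution.fourierInv_apply, Lp.fourierInv_toTemperedDistribution_eq,
      FourierTransform.fourierInv_fourier_eq]
  simpa only [Lp.toTemperedDistribution_apply, SchwartzMap.fourierInv_coe] using h

theorem ae_eq_fourierInv_of_integrable_fourier (f : Lp ℂ 2 (volume : Measure E))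
    (hF : Integrable (𝓕 f : Lp ℂ 2 (volume : Measure E))) :
    f =ᵐ[volume] 𝓕⁻ ((𝓕 f : Lp ℂ 2 (volume : Measure E)) : E → ℂ) := by
  refine ae_eq_of_integral_contDiff_smul_eq
    ((Lp.memLp f).locallyIntegrable one_le_two) ?_ fun g hg hgs => ?_
  · rw [Real.fourierInv_eq_fourier_comp_neg]
    exact (VectorFourier.fourierIntegral_continuous Real.continuous_fourierChar
      (innerSL ℝ).continuous₂ hF.comp_neg).locallyIntegrable
  · let φ : SchwartzMap E ℂ := (hgs.comp_left Complex.ofReal_zero).toSchwartzMap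
      (Complex.ofRealCLM.contDiff.comp hg)
    have hφ : ∀ (u : E → ℂ), ∫ x, g x • u x = ∫ x, φ x • u x := fun u =>
      integral_congr_ae (ae_of_all _ fun x => (Complex.coe_smul (g x) (u x)).symm)
    rw [hφ, hφ, Lp_apply_eq_fourier_apply_fourierInv, integral_fourierInv_smul_eq φ.integrable hF]

theorem norm_iteratedFDeriv_fourier_le {F : E → ℂ} {N n : ℕ} (hn : n ≤ N)
    (hm : AEStronglyMeasurable F) (hF : ∀ j ≤ N, Integrable fun ξ => ‖ξ‖ ^ j * ‖F ξ‖) (x : E) :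
    ‖iteratedFDeriv ℝ n (𝓕 F) x‖ ≤ (2 * Real.pi) ^ n * ∫ ξ, ‖ξ‖ ^ n * ‖F ξ‖ := by
  have hpow (ξ : E) : ‖VectorFourier.fourierPowSMulRight (innerSL ℝ : E →L[ℝ] E →L[ℝ] ℝ) F ξ n‖
      ≤ (2 * Real.pi) ^ n * (‖ξ‖ ^ n * ‖F ξ‖) := by
    refine (VectorFourier.norm_fourierPowSMulRight_le (innerSL ℝ) F ξ n).trans ?_
    rw [mul_assoc]
    gcongr ?_ ^ n * _
    exact mul_le_of_le_one_right Real.two_pi_pos.le (norm_innerSL_le ℝ)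
  rw [Real.iteratedFDeriv_fourier (N := N) (fun j hj => hF j (mod_cast hj)) hm (mod_cast hn),
    ← integral_const_mul]
  exact (VectorFourier.norm_fourierIntegral_le_integral_norm _ _ _ _ _).trans
    (integral_mono_of_nonneg (ae_of_all _ fun _ => norm_nonneg _) ((hF n hn).const_mul _)
      (ae_of_all _ hpow))

end Fourier

section C2Bound

variable {E : Type*} [NormedAddCommGroup E] [NormedSpace ℝ E] {G H : E → ℝ} {N N' : ℝ}

/-- `G` is of class `C²` and its derivatives of order `0`, `1` and `2` are bounded by `N` in norm:
a bound `N` for the `C²` norm of `G`, the norm in which the solutions are controlled. -/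
structure C2Bound (G : E → ℝ) (N : ℝ) : Prop where
  contDiff : ContDiff ℝ 2 G
  norm_iteratedFDeriv_le : ∀ n ≤ 2, ∀ x, ‖iteratedFDeriv ℝ n G x‖ ≤ N

namespace C2Bound

theorem mono (h : C2Bound G N) (hN : N ≤ N') : C2Bound G N' :=
  ⟨h.contDiff, fun n hn x => (h.norm_iteratedFDeriv_le n hn x).trans hN⟩

theorem add (hG : C2Bound G N) (hH : C2Bound H N') : C2Bound (fun x => G x + H x) (N + N') where
  contDiff := hG.contDiff.add hH.contDiff
  norm_iteratedFDeriv_le n hn x := by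
    have hn' : (n : WithTop ℕ∞) ≤ 2 := mod_cast hn
    rw [fun_iteratedFDeriv_add_apply (hG.contDiff.of_le hn').contDiffAt
      (hH.contDiff.of_le hn').contDiffAt]
    exact norm_add_le_of_le (hG.norm_iteratedFDeriv_le n hn x) (hH.norm_iteratedFDeriv_le n hn x)

theorem const_mul (hG : C2Bound G N) (c : ℝ) : C2Bound (fun x => c * G x) (|c| * N) where
  contDiff := contDiff_const.mul hG.contDiff
  norm_iteratedFDeriv_le n hn x := by
    have hn' : (n : WithTop ℕ∞) ≤ 2 := mod_cast hn
    have h := iteratedFDeriv_const_smul_apply' (a := c) (hG.contDiff.of_le hn').contDiffAt (x := x)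
    simp only [smul_eq_mul] at h
    rw [h, norm_smul, Real.norm_eq_abs]
    gcongr
    exact hG.norm_iteratedFDeriv_le n hn x

theorem abs_le (h : C2Bound G N) (x : E) : |G x| ≤ N := by
  simpa using h.norm_iteratedFDeriv_le 0 zero_le_two x

theorem nonneg (h : C2Bound G N) : 0 ≤ N :=
  (abs_nonneg _).trans (h.abs_le 0)

theorem norm_fderiv_le (h : C2Bound G N) (x : E) : ‖fderiv ℝ G x‖ ≤ N := by
  simpa only [norm_iteratedFDeriv_one] using h.norm_iteratedFDeriv_le 1 one_le_two x

theorem differentiable (h : C2Bound G N) : Differentiable ℝ G :=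
  h.contDiff.differentiable two_ne_zero

theorem differentiable_fderiv (h : C2Bound G N) : Differentiable ℝ (fderiv ℝ G) :=
  (h.contDiff.fderiv_right (m := 1) (by norm_num)).differentiable one_ne_zero

theorem norm_fderiv_sub_le (h : C2Bound G N) (x y : E) :
    ‖fderiv ℝ G x - fderiv ℝ G y‖ ≤ N * ‖x - y‖ :=
  convex_univ.norm_image_sub_le_of_norm_fderiv_le (𝕜 := ℝ)
    (fun z _ => h.differentiable_fderiv z)
    (fun z _ => by
      rw [← norm_iteratedFDeriv_one, norm_iteratedFDeriv_fderiv]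
      exact h.norm_iteratedFDeriv_le 2 le_rfl z)
    (mem_univ y) (mem_univ x)

theorem continuous_fderiv (h : C2Bound G N) : Continuous (fderiv ℝ G) :=
  h.contDiff.continuous_fderiv two_ne_zero

theorem abs_sub_sub_fderiv_le (h : C2Bound G N) (x y : E) :
    |G x - G (x - y) - fderiv ℝ G x y| ≤ N * ‖y‖ ^ 2 := by
  have hN := h.nonneg
  have htaylor := (convex_closedBall x ‖y‖).norm_image_sub_le_of_norm_hasFDerivWithin_le'
    (f := G) (f' := fderiv ℝ G) (φ := fderiv ℝ G x) (C := N * ‖y‖) (x := x - y) (y := x)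
    (fun z _ => (h.differentiable z).hasFDerivAt.hasFDerivWithinAt)
    (fun z hz => (h.norm_fderiv_sub_le z x).trans (by
      have := mem_closedBall_iff_norm.1 hz
      gcongr)) (by simp) (by simp)
  rw [sub_sub_cancel, Real.norm_eq_abs] at htaylor
  exact htaylor.trans_eq (by ring)

end C2Bound

end C2Bound

section FourierRegularity

variable {E : Type*} [NormedAddCommGroup E] [InnerProductSpace ℝ E] [FiniteDimensional ℝ E]
  [MeasurableSpace E] [BorelSpace E]

theorem pow_le_one_add_sq {r : ℝ} (hr : 0 ≤ r) {n : ℕ} (hn : n ≤ 2) : r ^ n ≤ 1 + r ^ 2 := by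
  interval_cases n <;> nlinarith

theorem integrable_pow_norm_mul_norm {F : E → ℂ} (hm : AEStronglyMeasurable F)
    (hF : Integrable fun ξ => (1 + ‖ξ‖ ^ 2) * ‖F ξ‖) {n : ℕ} (hn : n ≤ 2) :
    Integrable fun ξ => ‖ξ‖ ^ n * ‖F ξ‖ :=
  hF.mono' ((continuous_norm.pow n).aestronglyMeasurable.mul hm.norm) (ae_of_all _ fun ξ => by
    rw [Real.norm_of_nonneg (by positivity)]
    gcongr
    exact pow_le_one_add_sq (norm_nonneg ξ) hn)

theorem c2Bound_re_fourier {F : E → ℂ} (hm : AEStronglyMeasurable F)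
    (hF : Integrable fun ξ => (1 + ‖ξ‖ ^ 2) * ‖F ξ‖) :
    C2Bound (fun x => (𝓕 F x).re) ((2 * Real.pi) ^ 2 * ∫ ξ, (1 + ‖ξ‖ ^ 2) * ‖F ξ‖) := by
  have hmom : ∀ n ≤ 2, Integrable fun ξ => ‖ξ‖ ^ n * ‖F ξ‖ := fun n hn =>
    integrable_pow_norm_mul_norm hm hF hn
  have hC2 : ContDiff ℝ 2 (𝓕 F) :=
    Real.contDiff_fourier (N := (2 : ℕ)) fun n hn => hmom n (mod_cast hn)
  have hpi : 1 ≤ 2 * Real.pi := by linarith [Real.pi_gt_three]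
  refine ⟨Complex.reCLM.contDiff.comp hC2, fun n hn x => ?_⟩
  calc ‖iteratedFDeriv ℝ n (fun x => (𝓕 F x).re) x‖
      ≤ ‖Complex.reCLM‖ * ‖iteratedFDeriv ℝ n (𝓕 F) x‖ :=
        Complex.reCLM.norm_iteratedFDeriv_comp_left hC2.contDiffAt (mod_cast hn)
    _ = ‖iteratedFDeriv ℝ n (𝓕 F) x‖ := by rw [Complex.reCLM_norm, one_mul]
    _ ≤ (2 * Real.pi) ^ n * ∫ ξ, ‖ξ‖ ^ n * ‖F ξ‖ := norm_iteratedFDeriv_fourier_le hn hm hmom x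
    _ ≤ (2 * Real.pi) ^ 2 * ∫ ξ, (1 + ‖ξ‖ ^ 2) * ‖F ξ‖ := by
        gcongr ?_ * ?_
        · exact pow_le_pow_right₀ hpi hn
        · refine integral_mono (hmom n hn) hF fun ξ => ?_
          dsimp only
          gcongr
          exact pow_le_one_add_sq (norm_nonneg ξ) hn

theorem tendsto_re_fourier_cocompact (F : E → ℂ) :
    Tendsto (fun x => (𝓕 F x).re) (cocompact E) (𝓝 0) := by
  simpa only [Complex.zero_re] using!
    (Complex.continuous_re.tendsto 0).comp (tendsto_integral_exp_inner_smul_cocompact F)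

end FourierRegularity

section SobolevEmbedding

variable {k : ℕ} {g h : Plane → ℝ}

/-- The norm of the embedding of `H^k` into the functions whose Fourier transform is integrable
against `1 + |ξ|²`, as produced by the Cauchy-Schwarz inequality. It is infinite for small `k`. -/
noncomputable def embeddingConst (k : ℕ) : ℝ≥0∞ :=
  (∫⁻ ξ : Plane, ENNReal.ofReal
    ((1 + ‖ξ‖ ^ 2) ^ 2 / (1 + (2 * Real.pi * ‖ξ‖) ^ (2 * k)))) ^ (1 / 2 : ℝ)

theorem one_add_sq_pow_four_le (hk : 4 ≤ k) {r : ℝ} (hr : 0 ≤ r) :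
    (1 + r ^ 2) ^ 4 ≤ 16 * (1 + (2 * Real.pi * r) ^ (2 * k)) := by
  have hpi : 1 ≤ 2 * Real.pi := by linarith [Real.pi_gt_three]
  have hpow : 0 ≤ (2 * Real.pi * r) ^ (2 * k) := by positivity
  rcases le_total r 1 with h | h
  · calc (1 + r ^ 2) ^ 4 ≤ (1 + 1 ^ 2) ^ 4 := by gcongr
      _ ≤ 16 * (1 + (2 * Real.pi * r) ^ (2 * k)) := by linarith
  · calc (1 + r ^ 2) ^ 4 ≤ (r ^ 2 + r ^ 2) ^ 4 := by
          gcongr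
          exact one_le_pow₀ h
      _ = 16 * r ^ 8 := by ring
      _ ≤ 16 * (2 * Real.pi * r) ^ (2 * k) := by
          gcongr 16 * ?_
          exact (pow_le_pow_right₀ h (by lia)).trans
            (pow_le_pow_left₀ hr (le_mul_of_one_le_left hr hpi) _)
      _ ≤ 16 * (1 + (2 * Real.pi * r) ^ (2 * k)) := by linarith

theorem embeddingConst_lt_top (hk : 4 ≤ k) : embeddingConst k < ∞ := by
  have hint : Integrable fun ξ : Plane => 16 * (1 + ‖ξ‖ ^ 2) ^ (-(4 : ℝ) / 2) :=
    (integrable_rpow_neg_one_add_norm_sq (by simp; norm_num)).const_mul 16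
  have hle (ξ : Plane) : (1 + ‖ξ‖ ^ 2) ^ 2 / (1 + (2 * Real.pi * ‖ξ‖) ^ (2 * k))
      ≤ 16 * (1 + ‖ξ‖ ^ 2) ^ (-(4 : ℝ) / 2) := by
    have hexp : (1 + ‖ξ‖ ^ 2) ^ (-(4 : ℝ) / 2) = ((1 + ‖ξ‖ ^ 2) ^ 2)⁻¹ := by
      rw [show -(4 : ℝ) / 2 = -((2 : ℕ) : ℝ) by norm_num, Real.rpow_neg (by positivity),
        Real.rpow_natCast]
    rw [hexp, ← div_eq_mul_inv, div_le_div_iff₀ (by positivity) (by positivity), ← pow_add]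
    exact one_add_sq_pow_four_le hk (norm_nonneg ξ)
  exact ENNReal.rpow_lt_top_of_nonneg (by norm_num)
    ((lintegral_mono fun ξ => ENNReal.ofReal_le_ofReal (hle ξ)).trans_lt hint.lintegral_lt_top).ne

theorem lintegral_one_add_sq_mul_fourierL2_le (k : ℕ)
    (hm : AEStronglyMeasurable (fourierL2 g) volume) :
    ∫⁻ ξ, ENNReal.ofReal (1 + ‖ξ‖ ^ 2) * ‖fourierL2 g ξ‖ₑ
      ≤ embeddingConst k * sobolevNorm k g := by
  let w : Plane → ℝ := fun ξ => 1 + (2 * Real.pi * ‖ξ‖) ^ (2 * k)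
  have hw0 (ξ : Plane) : 0 < w ξ := by positivity
  calc ∫⁻ ξ, ENNReal.ofReal (1 + ‖ξ‖ ^ 2) * ‖fourierL2 g ξ‖ₑ
      = ∫⁻ ξ, ENNReal.ofReal ((1 + ‖ξ‖ ^ 2) / √(w ξ))
          * (ENNReal.ofReal √(w ξ) * ‖fourierL2 g ξ‖ₑ) := by
        refine lintegral_congr fun ξ => ?_
        rw [← mul_assoc, ← ENNReal.ofReal_mul (by positivity),
          div_mul_cancel₀ _ (Real.sqrt_pos.2 (hw0 ξ)).ne']
    _ ≤ (∫⁻ ξ, ENNReal.ofReal ((1 + ‖ξ‖ ^ 2) / √(w ξ)) ^ (2 : ℝ)) ^ (1 / 2 : ℝ)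
          * (∫⁻ ξ, (ENNReal.ofReal √(w ξ) * ‖fourierL2 g ξ‖ₑ) ^ (2 : ℝ)) ^ (1 / 2 : ℝ) :=
        ENNReal.lintegral_mul_le_Lp_mul_Lq volume Real.HolderConjugate.two_two
          (by fun_prop) ((by fun_prop : AEMeasurable _ _).mul hm.enorm)
    _ = embeddingConst k * sobolevNorm k g := by
        unfold embeddingConst sobolevNorm
        congr! 4 with ξ ξ
        · rw [ENNReal.ofReal_rpow_of_nonneg (by positivity) zero_le_two, Real.rpow_two, div_pow,
            Real.sq_sqrt (hw0 ξ).le]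
        · rw [ENNReal.rpow_two, mul_pow, ← ENNReal.ofReal_pow (by positivity),
            Real.sq_sqrt (hw0 ξ).le]

theorem fourierL2_eq_fourier_toLp (hg : MemLp (fun x => (g x : ℂ)) 2 volume) :
    fourierL2 g = (𝓕 (hg.toLp fun x => (g x : ℂ)) : Lp ℂ 2 (volume : Measure Plane)) :=
  dif_pos hg

theorem fourierL2_congr_ae (hgh : g =ᵐ[volume] h) : fourierL2 g = fourierL2 h := by
  have hC : (fun x => (g x : ℂ)) =ᵐ[volume] fun x => (h x : ℂ) :=
    hgh.fun_comp fun r : ℝ => (r : ℂ)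
  by_cases hg : MemLp (fun x => (g x : ℂ)) 2 volume
  · have hh := (memLp_congr_ae hC).1 hg
    rw [fourierL2_eq_fourier_toLp hg, fourierL2_eq_fourier_toLp hh,
      (MemLp.toLp_eq_toLp_iff hg hh).2 hC]
  · rw [fourierL2, fourierL2, dif_neg hg, dif_neg fun hh => hg ((memLp_congr_ae hC).2 hh)]

theorem sobolevNorm_congr_ae (hgh : g =ᵐ[volume] h) : sobolevNorm k g = sobolevNorm k h := by
  rw [sobolevNorm, fourierL2_congr_ae hgh, sobolevNorm]

theorem MemH.integrable_one_add_sq_mul_fourierL2 (hk : 4 ≤ k) (hg : MemH k g) :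
    AEStronglyMeasurable (fourierL2 g) volume ∧
      Integrable (fun ξ => (1 + ‖ξ‖ ^ 2) * ‖fourierL2 g ξ‖) ∧
      ∫ ξ, (1 + ‖ξ‖ ^ 2) * ‖fourierL2 g ξ‖ ≤ (embeddingConst k * sobolevNorm k g).toReal := by
  have hg2 : MemLp (fun x => (g x : ℂ)) 2 volume := hg.1.ofReal
  have hm : AEStronglyMeasurable (fourierL2 g) volume := by
    rw [fourierL2_eq_fourier_toLp hg2]
    exact Lp.aestronglyMeasurable _
  have hmw : AEStronglyMeasurable (fun ξ => (1 + ‖ξ‖ ^ 2) * ‖fourierL2 g ξ‖) volume :=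
    (by fun_prop : Continuous fun ξ : Plane => 1 + ‖ξ‖ ^ 2).aestronglyMeasurable.mul hm.norm
  have hnn : 0 ≤ᵐ[volume] fun ξ => (1 + ‖ξ‖ ^ 2) * ‖fourierL2 g ξ‖ :=
    ae_of_all _ fun ξ => by positivity
  have hle : ∫⁻ ξ, ENNReal.ofReal ((1 + ‖ξ‖ ^ 2) * ‖fourierL2 g ξ‖)
      ≤ embeddingConst k * sobolevNorm k g := by
    refine (lintegral_congr fun ξ => ?_).trans_le (lintegral_one_add_sq_mul_fourierL2_le k hm)
    rw [ENNReal.ofReal_mul (by positivity), ofReal_norm]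
  have htop : embeddingConst k * sobolevNorm k g < ∞ :=
    ENNReal.mul_lt_top (embeddingConst_lt_top hk) hg.2
  refine ⟨hm, ⟨hmw, ?_⟩, ?_⟩
  · exact (hasFiniteIntegral_iff_ofReal hnn).2 (hle.trans_lt htop)
  · rw [integral_eq_lintegral_of_nonneg_ae hnn hmw]
    exact ENNReal.toReal_mono htop.ne hle

theorem MemH.exists_ae_eq_c2Bound (hk : 4 ≤ k) (hg : MemH k g) :
    ∃ G : Plane → ℝ, g =ᵐ[volume] G ∧
      C2Bound G ((2 * Real.pi) ^ 2 * (embeddingConst k * sobolevNorm k g).toReal) ∧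
      Tendsto G (cocompact Plane) (𝓝 0) := by
  obtain ⟨hm, hint, hle⟩ := hg.integrable_one_add_sq_mul_fourierL2 hk
  have hC2 := c2Bound_re_fourier (F := fun ξ => fourierL2 g (-ξ))
    (hm.comp_measurePreserving (Measure.measurePreserving_neg volume))
    (by simpa only [norm_neg] using hint.comp_neg)
  refine ⟨fun x => (𝓕 (fun ξ => fourierL2 g (-ξ)) x).re, ?_, hC2.mono ?_,
    tendsto_re_fourier_cocompact _⟩
  · have hF : Integrable (fourierL2 g) := (integrable_norm_iff hm).1 <| by
      simpa only [pow_zero, one_mul] using integrable_pow_norm_mul_norm hm hint zero_le_two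
    have hg2 : MemLp (fun x => (g x : ℂ)) 2 volume := hg.1.ofReal
    rw [fourierL2_eq_fourier_toLp hg2] at hF ⊢
    filter_upwards [ae_eq_fourierInv_of_integrable_fourier _ hF, hg2.coeFn_toLp] with x hx hx'
    rw [← Real.fourierInv_eq_fourier_comp_neg, ← hx, hx', Complex.ofReal_re]
  · have hneg := integral_neg_eq_self (fun ξ => (1 + ‖ξ‖ ^ 2) * ‖fourierL2 g ξ‖) volume
    simp only [norm_neg] at hneg
    rw [hneg]
    gcongr

theorem MemH.c2Bound (hk : 4 ≤ k) (hg : MemH k g) (hc : Continuous g) :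
    C2Bound g ((2 * Real.pi) ^ 2 * (embeddingConst k * sobolevNorm k g).toReal) := by
  obtain ⟨G, hae, hG, -⟩ := hg.exists_ae_eq_c2Bound hk
  exact ((hc.ae_eq_iff_eq volume hG.contDiff.continuous).1 hae) ▸ hG

theorem MemH.tendsto_cocompact (hk : 4 ≤ k) (hg : MemH k g) (hc : Continuous g) :
    Tendsto g (cocompact Plane) (𝓝 0) := by
  obtain ⟨G, hae, hG, hG0⟩ := hg.exists_ae_eq_c2Bound hk
  exact ((hc.ae_eq_iff_eq volume hG.contDiff.continuous).1 hae) ▸ hG0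

end SobolevEmbedding

theorem C2Bound.of_sobolevNorm_sub_lt_one {k : ℕ} (hk : 4 ≤ k) {u v w G : Plane → ℝ} {N r : ℝ}
    (hu : MemH k u) (hv : MemH k v) (hw : MemH k w) (hcu : Continuous u) (hcv : Continuous v)
    (hwG : w =ᵐ[volume] G) (hG : C2Bound G N) (hr : r ≠ 0)
    (h : sobolevNorm k (fun x => r⁻¹ * (u x - v x) - w x) < 1) :
    C2Bound (fun x => u x - v x) (|r| * ((2 * Real.pi) ^ 2 * (embeddingConst k).toReal + N)) := by
  have hae : (fun x => r⁻¹ * (u x - v x) - w x) =ᵐ[volume]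
      fun x => r⁻¹ * (u x - v x) - G x := by
    filter_upwards [hwG] with x hx
    rw [hx]
  rw [sobolevNorm_congr_ae hae] at h
  have hmem : MemH k (fun x => r⁻¹ * (u x - v x) - G x) :=
    ⟨(memLp_congr_ae hae).1 (((hu.1.sub hv.1).const_mul _).sub hw.1), h.trans ENNReal.one_lt_top⟩
  have hquot : C2Bound (fun x => r⁻¹ * (u x - v x) - G x)
      ((2 * Real.pi) ^ 2 * (embeddingConst k).toReal) := by
    refine (hmem.c2Bound hk ((continuous_const.mul (hcu.sub hcv)).sub
      hG.contDiff.continuous)).mono ?_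
    gcongr
    · exact (embeddingConst_lt_top hk).ne
    · exact mul_le_of_le_one_right' h.le
  convert (hquot.add hG).const_mul r using 2
  field_simp
  ring

theorem IsC1Curve.exists_eventually_c2Bound_sub {k : ℕ} (hk : 4 ≤ k) {T : ℝ} {f : ℝ → Plane → ℝ}
    (hf : IsC1Curve k T f) (hc : ∀ t ∈ Icc 0 T, Continuous (f t)) {t : ℝ} (ht : t ∈ Icc 0 T) :
    ∃ K, ∀ᶠ s in 𝓝[Icc 0 T] t, C2Bound (fun x => f s x - f t x) (|s - t| * K) := by
  obtain ⟨hH, f', hf', hlim, -⟩ := hf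
  obtain ⟨G, hGae, hG, -⟩ := (hf' t ht).exists_ae_eq_c2Bound hk
  have hev := (tendsto_order.1 (hlim t ht)).2 1 zero_lt_one
  refine ⟨(2 * Real.pi) ^ 2 * (embeddingConst k).toReal
    + (2 * Real.pi) ^ 2 * (embeddingConst k * sobolevNorm k (f' t)).toReal, ?_⟩
  rw [eventually_nhdsWithin_iff] at hev ⊢
  filter_upwards [hev] with s hs hsI
  rcases eq_or_ne s t with rfl | hst
  · simpa using hG.const_mul 0
  · exact C2Bound.of_sobolevNorm_sub_lt_one hk (hH s hsI) (hH t ht) (hf' t ht) (hc s hsI)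
      (hc t ht) hGae hG (sub_ne_zero.2 hst) (hs ⟨hsI, hst⟩)

section SlopeKernel

variable {α ε m a p q : ℝ}

/-- The weight `(1 + s²)^{-(3+α)/2}` with which a slope `s` enters the contour equation in polar
coordinates. -/
noncomputable def slopeWeight (α s : ℝ) : ℝ := (1 + s ^ 2) ^ (-((3 + α) / 2))

/-- The primitive of `slopeWeight α` vanishing at `0`. -/
noncomputable def slopePrimitive (α q : ℝ) : ℝ := ∫ s in (0 : ℝ)..q, slopeWeight α s

/-- What remains of the integrand of the contour equation along a ray after an integration by
parts, as a function of the slope `q`; the parameter `a` is the directional derivative at the base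
point. -/
noncomputable def slopeKernel (α a q : ℝ) : ℝ := (a - q) * slopeWeight α q - α * slopePrimitive α q

theorem continuous_slopeWeight (α : ℝ) : Continuous (slopeWeight α) :=
  (by fun_prop : Continuous fun s : ℝ => 1 + s ^ 2).rpow_const fun s => Or.inl (by positivity)

theorem slopeWeight_nonneg (α s : ℝ) : 0 ≤ slopeWeight α s := by
  unfold slopeWeight; positivity

theorem slopeWeight_le_one (hα : -3 ≤ α) (s : ℝ) : slopeWeight α s ≤ 1 :=
  Real.rpow_le_one_of_one_le_of_nonpos (by nlinarith [sq_nonneg s]) (by linarith)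

theorem hasDerivAt_slopeWeight (α q : ℝ) :
    HasDerivAt (slopeWeight α) (-(3 + α) * q * (1 + q ^ 2) ^ (-((5 + α) / 2))) q := by
  refine (((hasDerivAt_pow 2 q).const_add 1).rpow_const (p := -((3 + α) / 2))
    (Or.inl (by positivity))).congr_deriv ?_
  rw [show -((3 + α) / 2) - 1 = -((5 + α) / 2) by ring]
  push_cast
  ring

theorem hasDerivAt_slopePrimitive (α q : ℝ) :
    HasDerivAt (slopePrimitive α) (slopeWeight α q) q :=
  (continuous_slopeWeight α).integral_hasStrictDerivAt 0 q |>.hasDerivAt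

theorem slopePrimitive_monotone (α : ℝ) : Monotone (slopePrimitive α) :=
  monotone_of_hasDerivAt_nonneg (hasDerivAt_slopePrimitive α) (slopeWeight_nonneg α)

theorem slopePrimitive_sub_le (hα : -3 ≤ α) (hpq : p ≤ q) :
    slopePrimitive α q - slopePrimitive α p ≤ q - p := by
  have hmono : Monotone fun q => q - slopePrimitive α q :=
    monotone_of_hasDerivAt_nonneg (fun q => (hasDerivAt_id q).sub (hasDerivAt_slopePrimitive α q))
      fun q => sub_nonneg.2 (slopeWeight_le_one hα q)
  linarith [hmono hpq]

theorem hasDerivAt_slopeKernel (α a q : ℝ) :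
    HasDerivAt (slopeKernel α a)
      ((1 + q ^ 2) ^ (-((5 + α) / 2)) * (-(1 + α) + 2 * q ^ 2 - (3 + α) * (a * q))) q := by
  have hw : slopeWeight α q = (1 + q ^ 2) ^ (-((5 + α) / 2)) * (1 + q ^ 2) := by
    rw [slopeWeight, ← Real.rpow_add_one (by positivity)]
    ring_nf
  refine ((((hasDerivAt_id q).const_sub a).mul (hasDerivAt_slopeWeight α q)).sub
    ((hasDerivAt_slopePrimitive α q).const_mul α)).congr_deriv ?_
  rw [hw, id]
  ring

theorem one_eighth_le_rpow (hα : α < 1) {x : ℝ} (hx : 1 ≤ x) (hx2 : x ≤ 2) :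
    1 / 8 ≤ x ^ (-((5 + α) / 2)) :=
  calc (1 / 8 : ℝ) = 2 ^ (-(3 : ℝ)) := by
        rw [Real.rpow_neg zero_le_two, ← Nat.cast_ofNat (R := ℝ) (n := 3), Real.rpow_natCast]
        norm_num
    _ ≤ x ^ (-(3 : ℝ)) := Real.rpow_le_rpow_of_nonpos (by linarith) hx2 (by norm_num)
    _ ≤ x ^ (-((5 + α) / 2)) := Real.rpow_le_rpow_of_exponent_le hx (by linarith)

theorem sq_le_one_of_threshold (hα : -1 < α) (hε : 0 < ε)
    (hm : (5 + α + ε) * m ^ 2 ≤ 1 + α - ε) : m ^ 2 ≤ 1 := by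
  nlinarith

theorem slopeKernel_add_antitoneOn (hα : α ∈ Ioo (-1) 1) (hε : 0 < ε)
    (hm : (5 + α + ε) * m ^ 2 ≤ 1 + α - ε) (ha : |a| ≤ m) :
    AntitoneOn (fun q => slopeKernel α a q + ε / 8 * q) (Icc (-m) m) := by
  have hder (q : ℝ) := (hasDerivAt_slopeKernel α a q).add ((hasDerivAt_id q).const_mul (ε / 8))
  refine antitoneOn_of_hasDerivWithinAt_nonpos (convex_Icc _ _)
    (fun q _ => (hder q).continuousAt.continuousWithinAt)
    (fun q _ => (hder q).hasDerivWithinAt) fun q hq => ?_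
  have hqI : q ∈ Icc (-m) m := interior_subset hq
  have hqm : |q| ≤ m := abs_le.2 hqI
  have hm0 : 0 ≤ m := (abs_nonneg a).trans ha
  have hq2 : q ^ 2 ≤ m ^ 2 := sq_le_sq' (abs_le.1 hqm).1 (abs_le.1 hqm).2
  have hweight : 1 / 8 ≤ (1 + q ^ 2) ^ (-((5 + α) / 2)) :=
    one_eighth_le_rpow hα.2 (by nlinarith) (by linarith [sq_le_one_of_threshold hα.1 hε hm])
  have haq : -m ^ 2 ≤ a * q := by
    have : |a * q| ≤ m ^ 2 := by
      rw [abs_mul, sq]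
      gcongr
    exact (abs_le.1 this).1
  have hbracket : -(1 + α) + 2 * q ^ 2 - (3 + α) * (a * q) ≤ -ε := by
    nlinarith [hα.1, sq_nonneg m]
  nlinarith

end SlopeKernel

section Ray

variable {α ε m a δ R r : ℝ} {u u' W W' : ℝ → ℝ}

/-- The boundary term of the integration by parts along a ray, for a profile `u` on the ray. -/
noncomputable def radialBoundary (α : ℝ) (u : ℝ → ℝ) (r : ℝ) : ℝ :=
  -(r ^ (-α) * slopePrimitive α (u r / r))

theorem hasDerivAt_radialBoundary {v' : ℝ} (hr : 0 < r) (hu : HasDerivAt u v' r) :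
    HasDerivAt (radialBoundary α u)
      (r ^ (-1 - α) * ((a - v') * slopeWeight α (u r / r) - slopeKernel α a (u r / r))) r := by
  refine ((Real.hasDerivAt_rpow_const (p := -α) (Or.inl hr.ne')).mul
    (HasDerivAt.comp (h := fun r => u r / r) r (hasDerivAt_slopePrimitive α (u r / r))
      (hu.div (hasDerivAt_id r) hr.ne'))).neg.congr_deriv ?_
  have hpred : r ^ (-α - 1) = r ^ (-1 - α) := by ring_nf
  have hsucc : r ^ (-α) = r ^ (-1 - α) * r := by
    rw [← Real.rpow_add_one hr.ne']
    ring_nf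
  rw [hpred, hsucc, slopeKernel]
  simp only [Function.comp_apply]
  field_simp
  ring

theorem radialBoundary_le (α : ℝ) (hr : 0 < r) (huW : u r ≤ W r) :
    radialBoundary α W r ≤ radialBoundary α u r :=
  neg_le_neg <| mul_le_mul_of_nonneg_left
    (slopePrimitive_monotone α (div_le_div_of_nonneg_right huW hr.le)) (Real.rpow_nonneg hr.le _)

theorem radialBoundary_sub_le (hα : -3 ≤ α) (hr : 0 < r) (huW : u r ≤ W r) :
    radialBoundary α u r - radialBoundary α W r ≤ r ^ (-1 - α) * (W r - u r) :=
  calc radialBoundary α u r - radialBoundary α W r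
      = r ^ (-α) * (slopePrimitive α (W r / r) - slopePrimitive α (u r / r)) := by
        unfold radialBoundary
        ring
    _ ≤ r ^ (-α) * (W r / r - u r / r) :=
        mul_le_mul_of_nonneg_left
          (slopePrimitive_sub_le hα (div_le_div_of_nonneg_right huW hr.le))
          (Real.rpow_nonneg hr.le _)
    _ = r ^ (-1 - α) * (W r - u r) := by
        rw [show -α = -1 - α + 1 by ring, Real.rpow_add_one hr.ne']
        field_simp

theorem continuousOn_ray_slope (hδ : 0 < δ) (hu : ∀ r ∈ Icc δ R, HasDerivAt u (u' r) r) :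
    ContinuousOn (fun r => u r / r) (Icc δ R) :=
  ContinuousOn.div (fun r hr => (hu r hr).continuousAt.continuousWithinAt) continuousOn_id
    fun _ hr => (hδ.trans_le hr.1).ne'

theorem continuousOn_ray_integrand (α a : ℝ) (hδ : 0 < δ)
    (hu : ∀ r ∈ Icc δ R, HasDerivAt u (u' r) r) (hu' : ContinuousOn u' (Icc δ R)) :
    ContinuousOn (fun r => (a - u' r) * slopeWeight α (u r / r)) (Icc δ R) :=
  (continuousOn_const.sub hu').mul <| (continuous_slopeWeight α).comp_continuousOn <|
    continuousOn_ray_slope hδ hu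

theorem integral_ray_sub_le (hα : α ∈ Ioo (-1) 1) (hε : 0 < ε)
    (hm : (5 + α + ε) * m ^ 2 ≤ 1 + α - ε) (ha : |a| ≤ m) (hδ : 0 < δ) (hδR : δ ≤ R)
    (hu : ∀ r ∈ Icc δ R, HasDerivAt u (u' r) r) (hW : ∀ r ∈ Icc δ R, HasDerivAt W (W' r) r)
    (hu' : ContinuousOn u' (Icc δ R)) (hW' : ContinuousOn W' (Icc δ R))
    (huW : ∀ r ∈ Icc δ R, u r ≤ W r) (hum : ∀ r ∈ Icc δ R, -m ≤ u r / r)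
    (hWm : ∀ r ∈ Icc δ R, W r / r ≤ m) :
    ∫ r in δ..R, r ^ (-1 - α) * ((a - W' r) * slopeWeight α (W r / r)
        - (a - u' r) * slopeWeight α (u r / r) + ε / 8 * (W r / r - u r / r))
      ≤ δ ^ (-1 - α) * (W δ - u δ) := by
  have hpos : ∀ r ∈ Icc δ R, 0 < r := fun r hr => hδ.trans_le hr.1
  have hslope : ∀ r ∈ Icc δ R, u r / r ≤ W r / r := fun r hr =>
    div_le_div_of_nonneg_right (huW r hr) (hpos r hr).le
  have hder (r) (hr : r ∈ Icc δ R) :=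
    (hasDerivAt_radialBoundary (α := α) (a := a) (hpos r hr) (hW r hr)).sub
      (hasDerivAt_radialBoundary (α := α) (a := a) (hpos r hr) (hu r hr))
  have hint : ContinuousOn (fun r => r ^ (-1 - α) * ((a - W' r) * slopeWeight α (W r / r)
      - (a - u' r) * slopeWeight α (u r / r) + ε / 8 * (W r / r - u r / r))) (Icc δ R) :=
    (continuousOn_id.rpow_const fun r hr => Or.inl (hpos r hr).ne').mul <|
      ((continuousOn_ray_integrand α a hδ hW hW').sub
        (continuousOn_ray_integrand α a hδ hu hu')).add
        (continuousOn_const.mul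
          ((continuousOn_ray_slope hδ hW).sub (continuousOn_ray_slope hδ hu)))
  have hle (r) (hr : r ∈ Icc δ R) :
      slopeKernel α a (W r / r) + ε / 8 * (W r / r)
        ≤ slopeKernel α a (u r / r) + ε / 8 * (u r / r) :=
    slopeKernel_add_antitoneOn hα hε hm ha ⟨hum r hr, (hslope r hr).trans (hWm r hr)⟩
      ⟨(hum r hr).trans (hslope r hr), hWm r hr⟩ (hslope r hr)
  have hδI : δ ∈ Icc δ R := left_mem_Icc.2 hδR
  have hRI : R ∈ Icc δ R := right_mem_Icc.2 hδR
  calc _ ≤ radialBoundary α W R - radialBoundary α u R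
        - (radialBoundary α W δ - radialBoundary α u δ) := by
        refine intervalIntegral.integral_le_sub_of_hasDeriv_right_of_le hδR
          (fun r hr => (hder r hr).continuousAt.continuousWithinAt)
          (fun r hr => (hder r (Ioo_subset_Icc_self hr)).hasDerivWithinAt)
          hint.integrableOn_Icc fun r hr => ?_
        have hrI := Ioo_subset_Icc_self hr
        rw [← mul_sub]
        exact mul_le_mul_of_nonneg_left (by linarith [hle r hrI])
          (Real.rpow_nonneg (hpos r hrI).le _)
    _ ≤ radialBoundary α u δ - radialBoundary α W δ := by
        linarith [radialBoundary_le α (hpos R hRI) (huW R hRI)]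
    _ ≤ δ ^ (-1 - α) * (W δ - u δ) :=
        radialBoundary_sub_le (by linarith [hα.1]) hδ (huW δ hδI)

end Ray

section Polar

theorem integral_volumeIoiPow (n : ℕ) (G : ℝ → ℝ) :
    ∫ r : Ioi (0 : ℝ), G r ∂Measure.volumeIoiPow n = ∫ r in Ioi (0 : ℝ), r ^ n * G r := by
  simp only [Measure.volumeIoiPow, ENNReal.ofReal]
  rw [integral_withDensity_eq_integral_smul (measurable_subtype_coe.pow_const _).real_toNNReal,
    integral_subtype_comap measurableSet_Ioi fun r => Real.toNNReal (r ^ n) • G r]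
  refine setIntegral_congr_fun measurableSet_Ioi fun r hr => ?_
  simp only [NNReal.smul_def, Real.coe_toNNReal _ (pow_nonneg (mem_Ioi.1 hr).le n), smul_eq_mul]

variable {E : Type*} [NormedAddCommGroup E] [NormedSpace ℝ E]

theorem homeomorphUnitSphereProd_snd_smul_fst (y : ({0}ᶜ : Set E)) :
    (homeomorphUnitSphereProd E y).2.1 • (homeomorphUnitSphereProd E y).1.1 = y.1 := by
  simpa using smul_inv_smul₀ (norm_ne_zero_iff.2 y.2) y.1

variable [MeasurableSpace E] [BorelSpace E] [FiniteDimensional ℝ E] {μ : Measure E}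
  [μ.IsAddHaarMeasure]

theorem integral_eq_integral_toSphere_prod [Nontrivial E] (F : E → ℝ) :
    ∫ y, F y ∂μ = ∫ p : Metric.sphere (0 : E) 1 × Ioi (0 : ℝ), F (p.2.1 • p.1.1)
      ∂μ.toSphere.prod (.volumeIoiPow (Module.finrank ℝ E - 1)) := by
  rw [← μ.measurePreserving_homeomorphUnitSphereProd.integral_comp
    (Homeomorph.measurableEmbedding _)]
  simp only [homeomorphUnitSphereProd_snd_smul_fst]
  rw [integral_subtype_comap (measurableSet_singleton _).compl F, restrict_compl_singleton]

theorem integrable_toSphere_prod {F : E → ℝ} (hF : Integrable F μ) :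
    Integrable (fun p : Metric.sphere (0 : E) 1 × Ioi (0 : ℝ) => F (p.2.1 • p.1.1))
      (μ.toSphere.prod (.volumeIoiPow (Module.finrank ℝ E - 1))) := by
  rw [← μ.measurePreserving_homeomorphUnitSphereProd.integrable_comp_emb
    (Homeomorph.measurableEmbedding _)]
  have hpolar : (fun p : Metric.sphere (0 : E) 1 × Ioi (0 : ℝ) => F (p.2.1 • p.1.1)) ∘
      homeomorphUnitSphereProd E = F ∘ Subtype.val :=
    funext fun y => congrArg F (homeomorphUnitSphereProd_snd_smul_fst y)
  rw [hpolar, ← integrableOn_iff_comap_subtypeVal (measurableSet_singleton _).compl]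
  exact hF.integrableOn

end Polar

section Annulus

variable {E : Type*} [NormedAddCommGroup E]

/-- The open annulus `δ < ‖y‖ < R`, over which the integrals defining the principal value are
taken. -/
def annulus (E : Type*) [NormedAddCommGroup E] (δ R : ℝ) : Set E := {y | δ < ‖y‖ ∧ ‖y‖ < R}

theorem annulus_subset_annulus {δ R R' : ℝ} (hR : R ≤ R') : annulus E δ R ⊆ annulus E δ R' :=
  fun _ hy => ⟨hy.1, hy.2.trans_le hR⟩

variable [MeasurableSpace E] [BorelSpace E]

theorem measurableSet_annulus (δ R : ℝ) : MeasurableSet (annulus E δ R) :=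
  ((isOpen_lt continuous_const continuous_norm).inter
    (isOpen_lt continuous_norm continuous_const)).measurableSet

variable [NormedSpace ℝ E] [FiniteDimensional ℝ E]

theorem integrableOn_annulus_rpow_mul (μ : Measure E) [IsFiniteMeasureOnCompacts μ] {δ : ℝ} (R : ℝ)
    (hδ : 0 < δ) (p : ℝ) {d : E → ℝ} (hd : Continuous d) :
    IntegrableOn (fun y => ‖y‖ ^ p * d y) (annulus E δ R) μ := by
  have := FiniteDimensional.proper_real E
  have hK : IsCompact {y : E | δ ≤ ‖y‖ ∧ ‖y‖ ≤ R} :=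
    (isCompact_closedBall (0 : E) R).of_isClosed_subset
      ((isClosed_le continuous_const continuous_norm).inter
        (isClosed_le continuous_norm continuous_const)) fun y hy => by simpa using hy.2
  refine IntegrableOn.mono_set (ContinuousOn.integrableOn_compact hK ?_)
    fun y hy => ⟨hy.1.le, hy.2.le⟩
  exact (continuous_norm.continuousOn.rpow_const fun y hy =>
    Or.inl (hδ.trans_le hy.1).ne').mul hd.continuousOn

variable [Nontrivial E] {μ : Measure E} [μ.IsAddHaarMeasure]

theorem setIntegral_annulus_le {F : E → ℝ} {δ R c : ℝ} (hδ : 0 ≤ δ) (hδR : δ ≤ R)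
    (hF : IntegrableOn F (annulus E δ R) μ)
    (hc : ∀ σ : E, ‖σ‖ = 1 → ∫ r in δ..R, r ^ (Module.finrank ℝ E - 1) * F (r • σ) ≤ c) :
    ∫ y in annulus E δ R, F y ∂μ ≤ μ.toSphere.real univ * c := by
  set A := annulus E δ R
  have hint := integrable_toSphere_prod
    ((integrable_indicator_iff (measurableSet_annulus δ R)).2 hF)
  have hray (σ : Metric.sphere (0 : E) 1) : ∫ r : Ioi (0 : ℝ), A.indicator F (r.1 • σ.1)
      ∂.volumeIoiPow (Module.finrank ℝ E - 1) ≤ c := by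
    have hσ : ‖σ.1‖ = 1 := by simp
    have hmem {r : ℝ} (hr : 0 < r) : r • σ.1 ∈ A ↔ r ∈ Ioo δ R := by
      simp [A, annulus, norm_smul, hσ, abs_of_pos hr]
    refine (le_of_eq ?_).trans (hc σ hσ)
    rw [integral_volumeIoiPow _ fun r => A.indicator F (r • σ.1),
      intervalIntegral.integral_of_le hδR, integral_Ioc_eq_integral_Ioo,
      setIntegral_eq_of_subset_of_forall_sdiff_eq_zero (s := Ioo δ R) measurableSet_Ioi
        (Ioo_subset_Ioi_self.trans (Ioi_subset_Ioi hδ)) fun r hr => ?_]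
    · refine setIntegral_congr_fun measurableSet_Ioo fun r hr => ?_
      simp only [indicator_of_mem ((hmem (hδ.trans_lt hr.1)).2 hr)]
    · rw [indicator_of_notMem fun h => hr.2 ((hmem hr.1).1 h), mul_zero]
  calc ∫ y in A, F y ∂μ = ∫ σ : Metric.sphere (0 : E) 1, ∫ r : Ioi (0 : ℝ),
        A.indicator F (r.1 • σ.1) ∂.volumeIoiPow (Module.finrank ℝ E - 1) ∂μ.toSphere := by
        rw [← integral_indicator (measurableSet_annulus δ R), integral_eq_integral_toSphere_prod,
          integral_prod _ hint]
    _ ≤ ∫ _ : Metric.sphere (0 : E) 1, c ∂μ.toSphere :=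
        integral_mono hint.integral_prod_left (integrable_const _) hray
    _ = μ.toSphere.real univ * c := by rw [integral_const, smul_eq_mul]

theorem volume_real_annulus {δ R : ℝ} (hδ : 0 ≤ δ) (hδR : δ < R) :
    (volume : Measure Plane).real (annulus Plane δ R) = Real.pi * (R ^ 2 - δ ^ 2) := by
  have hdiff : annulus Plane δ R = Metric.ball 0 R \ Metric.closedBall 0 δ := by
    ext y
    simp [annulus, and_comm]
  rw [hdiff, measureReal_sdiff (Metric.closedBall_subset_ball hδR)
    Metric.isClosed_closedBall.measurableSet, measureReal_def, measureReal_def,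
    EuclideanSpace.volume_ball_fin_two, EuclideanSpace.volume_closedBall_fin_two]
  simp [Real.pi_pos.le, hδ, hδ.trans hδR.le]
  ring

end Annulus

section Translation

variable {E F : Type*} [NormedAddCommGroup E] [NormedSpace ℝ E] [NormedAddCommGroup F]
  [NormedSpace ℝ F] [CompleteSpace F]

theorem enorm_fwdDiff_le {g : E → F} (hg : ContDiff ℝ 1 g) (w z : E) :
    ‖Δ_[w] g z‖ₑ ≤ ∫⁻ s in Ioc (0 : ℝ) 1, ‖fderiv ℝ g (z + s • w)‖ₑ * ‖w‖ₑ := by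
  have hline (s : ℝ) : HasDerivAt (fun s : ℝ => z + s • w) w s := by
    simpa using ((hasDerivAt_id s).smul_const w).const_add z
  have hder (s : ℝ) : HasDerivAt (fun s : ℝ => g (z + s • w)) (fderiv ℝ g (z + s • w) w) s :=
    (hg.differentiable one_ne_zero _).hasFDerivAt.comp_hasDerivAt s (hline s)
  have hcont : Continuous fun s : ℝ => fderiv ℝ g (z + s • w) w :=
    ((hg.continuous_fderiv one_ne_zero).comp (by fun_prop)).clm_apply continuous_const
  have hftc := intervalIntegral.integral_eq_sub_of_hasDerivAt (fun s _ => hder s)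
    (hcont.intervalIntegrable 0 1)
  simp only [one_smul, zero_smul, add_zero] at hftc
  rw [fwdDiff, ← hftc, intervalIntegral.integral_of_le zero_le_one]
  exact (enorm_integral_le_lintegral_enorm _).trans <| lintegral_mono fun s =>
    (fderiv ℝ g (z + s • w)).le_opENorm w

variable [MeasurableSpace E] [BorelSpace E] {μ : Measure E} [SFinite μ]
  [μ.IsAddRightInvariant]

theorem lintegral_enorm_fwdDiff_le {g : E → F} (hg : ContDiff ℝ 1 g) (w : E) :
    ∫⁻ z, ‖Δ_[w] g z‖ₑ ∂μ ≤ ‖w‖ₑ * eLpNorm (fderiv ℝ g) 1 μ := by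
  have hcont : Continuous fun p : E × ℝ => ‖fderiv ℝ g (p.1 + p.2 • w)‖ₑ * ‖w‖ₑ :=
    (ENNReal.continuous_mul_const enorm_ne_top).comp
      ((hg.continuous_fderiv one_ne_zero).comp (by fun_prop)).enorm
  calc ∫⁻ z, ‖Δ_[w] g z‖ₑ ∂μ
      ≤ ∫⁻ z, (∫⁻ s in Ioc (0 : ℝ) 1, ‖fderiv ℝ g (z + s • w)‖ₑ * ‖w‖ₑ) ∂μ :=
        lintegral_mono (enorm_fwdDiff_le hg w)
    _ = ∫⁻ s in Ioc (0 : ℝ) 1, ∫⁻ z, ‖fderiv ℝ g (z + s • w)‖ₑ * ‖w‖ₑ ∂μ :=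
        lintegral_lintegral_swap hcont.measurable.aemeasurable
    _ = ∫⁻ _ in Ioc (0 : ℝ) 1, ‖w‖ₑ * eLpNorm (fderiv ℝ g) 1 μ := by
        refine lintegral_congr fun _ => ?_
        rw [lintegral_mul_const' _ _ enorm_ne_top, eLpNorm_one_eq_lintegral_enorm,
          lintegral_add_right_eq_self (fun z => ‖fderiv ℝ g z‖ₑ), mul_comm]
    _ = ‖w‖ₑ * eLpNorm (fderiv ℝ g) 1 μ := by simp

variable {g : E → ℝ} {M : ℝ}

theorem lintegral_enorm_fwdDiff_le_ofReal (hg : ContDiff ℝ 1 g)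
    (hM : eLpNorm (fderiv ℝ g) 1 μ ≤ ENNReal.ofReal M) (w : E) :
    ∫⁻ z, ‖Δ_[w] g z‖ₑ ∂μ ≤ ENNReal.ofReal (‖w‖ * M) := by
  rw [ENNReal.ofReal_mul (norm_nonneg w), ofReal_norm]
  exact (lintegral_enorm_fwdDiff_le hg w).trans (by gcongr)

theorem integrable_fwdDiff (hg : ContDiff ℝ 1 g)
    (hM : eLpNorm (fderiv ℝ g) 1 μ ≤ ENNReal.ofReal M) (w : E) : Integrable (Δ_[w] g) μ :=
  have hcont : Continuous (Δ_[w] g) := (hg.continuous.comp (by fun_prop)).sub hg.continuous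
  ⟨hcont.aestronglyMeasurable,
    (lintegral_enorm_fwdDiff_le_ofReal hg hM w).trans_lt ENNReal.ofReal_lt_top⟩

theorem integral_abs_fwdDiff_le (hg : ContDiff ℝ 1 g) (hM0 : 0 ≤ M)
    (hM : eLpNorm (fderiv ℝ g) 1 μ ≤ ENNReal.ofReal M) (w : E) :
    ∫ z, |Δ_[w] g z| ∂μ ≤ ‖w‖ * M := by
  simp_rw [← Real.norm_eq_abs]
  rw [integral_norm_eq_lintegral_enorm (integrable_fwdDiff hg hM w).aestronglyMeasurable]
  exact ENNReal.toReal_le_of_le_ofReal (by positivity) (lintegral_enorm_fwdDiff_le_ofReal hg hM w)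

end Translation

section Dissipation

theorem le_setIntegral_annulus_rpow_mul_sub {D : Plane → ℝ} {α δ L R R₀ : ℝ} {x : Plane}
    (hα : -3 ≤ α) (hcont : Continuous D) (hint : Integrable D) (hL : ∫ z, |D z| ≤ L)
    (hmax : ∀ z, D z ≤ D x) (hδ : 0 < δ) (hδR : δ < R₀) (hR : R₀ ≤ R) :
    R₀ ^ (-3 - α) * (D x * (Real.pi * (R₀ ^ 2 - δ ^ 2)) - L)
      ≤ ∫ y in annulus Plane δ R, ‖y‖ ^ (-3 - α) * (D x - D (x - y)) := by
  have hconst : IntegrableOn (fun _ => D x) (annulus Plane δ R₀) :=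
    integrableOn_const (measure_ne_top_of_subset
      (fun y hy => mem_ball_zero_iff.2 hy.2) measure_ball_lt_top.ne)
  have hshift : Integrable fun y => D (x - y) := hint.comp_sub_left x
  have hkernel (R : ℝ) : IntegrableOn (fun y => ‖y‖ ^ (-3 - α) * (D x - D (x - y)))
      (annulus Plane δ R) := integrableOn_annulus_rpow_mul volume R hδ _ (by fun_prop)
  have hle_L : ∫ y in annulus Plane δ R₀, D (x - y) ≤ L :=
    calc ∫ y in annulus Plane δ R₀, D (x - y) ≤ ∫ y in annulus Plane δ R₀, |D (x - y)| :=
          integral_mono hshift.integrableOn hshift.abs.integrableOn fun y => le_abs_self _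
      _ ≤ ∫ y, |D (x - y)| :=
          setIntegral_le_integral hshift.abs (ae_of_all _ fun y => abs_nonneg _)
      _ = ∫ y, |D y| := integral_sub_left_eq_self (fun y => |D y|) volume x
      _ ≤ L := hL
  calc R₀ ^ (-3 - α) * (D x * (Real.pi * (R₀ ^ 2 - δ ^ 2)) - L)
      ≤ R₀ ^ (-3 - α) * ∫ y in annulus Plane δ R₀, (D x - D (x - y)) := by
        rw [integral_sub hconst hshift.integrableOn, setIntegral_const,
          volume_real_annulus hδ.le hδR, smul_eq_mul]
        exact mul_le_mul_of_nonneg_left (by linarith) (Real.rpow_nonneg (hδ.trans hδR).le _)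
    _ = ∫ y in annulus Plane δ R₀, R₀ ^ (-3 - α) * (D x - D (x - y)) :=
        (integral_const_mul _ _).symm
    _ ≤ ∫ y in annulus Plane δ R₀, ‖y‖ ^ (-3 - α) * (D x - D (x - y)) :=
        setIntegral_mono_on ((hconst.sub hshift.integrableOn).const_mul _) (hkernel R₀)
          (measurableSet_annulus δ R₀) fun y hy => mul_le_mul_of_nonneg_right
            (Real.rpow_le_rpow_of_nonpos (hδ.trans hy.1) hy.2.le (by linarith))
            (sub_nonneg.2 (hmax _))
    _ ≤ ∫ y in annulus Plane δ R, ‖y‖ ^ (-3 - α) * (D x - D (x - y)) :=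
        setIntegral_mono_set (hkernel R)
          (ae_of_all _ fun y => mul_nonneg (by positivity) (sub_nonneg.2 (hmax _)))
          (annulus_subset_annulus hR).eventuallyLE

end Dissipation

section Velocity

theorem norm_gradient_eq {E : Type*} [NormedAddCommGroup E] [InnerProductSpace ℝ E]
    [CompleteSpace E] (g : E → ℝ) (x : E) : ‖∇ g x‖ = ‖fderiv ℝ g x‖ := by
  rw [← toDual_gradient, LinearIsometryEquiv.norm_map]

variable {α ε m N M δ R r v₁ v₂ : ℝ} {g : Plane → ℝ} {w x σ : Plane}

theorem mul_div_rpow_add_sq (hr : 0 < r) (b u : ℝ) :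
    r * (b * r / (r ^ 2 + u ^ 2) ^ ((3 + α) / 2))
      = r ^ (-1 - α) * (b * slopeWeight α (u / r)) := by
  have hfactor : r ^ 2 + u ^ 2 = r ^ 2 * (1 + (u / r) ^ 2) := by field_simp
  have hsq : (r ^ 2) ^ ((3 + α) / 2) = r ^ (3 + α) := by
    rw [← Real.rpow_natCast, ← Real.rpow_mul hr.le]
    push_cast
    ring_nf
  have hpow : r ^ (-1 - α) = r ^ 2 * (r ^ (3 + α))⁻¹ := by
    rw [← Real.rpow_neg hr.le, ← Real.rpow_natCast r 2, ← Real.rpow_add hr]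
    push_cast
    ring_nf
  rw [hfactor, Real.mul_rpow (by positivity) (by positivity), hsq, slopeWeight,
    Real.rpow_neg (by positivity), hpow]
  field_simp

theorem mul_contourIntegrand_smul (hσ : ‖σ‖ = 1) (hr : 0 < r) (g : Plane → ℝ) (x : Plane) :
    r * contourIntegrand α g x (r • σ) = r ^ (-1 - α) *
      ((fderiv ℝ g x σ - fderiv ℝ g (x - r • σ) σ)
        * slopeWeight α ((g x - g (x - r • σ)) / r)) := by
  rw [← mul_div_rpow_add_sq hr, contourIntegrand, norm_smul, hσ, mul_one,
    Real.norm_of_nonneg hr.le, inner_sub_left, inner_gradient_left, inner_gradient_left, map_smul,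
    map_smul, smul_eq_mul, smul_eq_mul, ← mul_sub, mul_comm r (_ - _)]

theorem mul_norm_smul_rpow_mul (hσ : ‖σ‖ = 1) (hr : 0 < r) (c : ℝ) :
    r * (‖r • σ‖ ^ (-3 - α) * c) = r ^ (-1 - α) * (c / r) := by
  rw [norm_smul, hσ, mul_one, Real.norm_of_nonneg hr.le, show -1 - α = -3 - α + 1 + 1 by ring,
    Real.rpow_add_one hr.ne', Real.rpow_add_one hr.ne']
  field_simp

theorem fderiv_add_eq_of_fwdDiff_le (hg : Differentiable ℝ g)
    (hmax : ∀ z, Δ_[w] g z ≤ Δ_[w] g x) : fderiv ℝ g (x + w) = fderiv ℝ g x := by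
  have hcrit : fderiv ℝ (fun z => g (z + w) - g z) x = 0 :=
    IsLocalMax.fderiv_eq_zero (Eventually.of_forall hmax)
  rw [fderiv_fun_sub (by fun_prop) (hg x), fderiv_comp_add_right] at hcrit
  exact sub_eq_zero.1 hcrit

theorem hasDerivAt_sub_ray (hg : Differentiable ℝ g) (x σ : Plane) (r : ℝ) :
    HasDerivAt (fun r : ℝ => g x - g (x - r • σ)) (fderiv ℝ g (x - r • σ) σ) r := by
  have hline : HasDerivAt (fun r : ℝ => x - r • σ) (-σ) r := by
    simpa using ((hasDerivAt_id r).smul_const σ).const_sub x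
  simpa using ((hg (x - r • σ)).hasFDerivAt.comp_hasDerivAt r hline).const_sub (g x)

theorem abs_sub_ray_div_le (hg : Differentiable ℝ g) (hgm : ∀ x, ‖fderiv ℝ g x‖ ≤ m)
    (hσ : ‖σ‖ = 1) (hr : 0 < r) (x : Plane) : |(g x - g (x - r • σ)) / r| ≤ m := by
  have hmvt : ‖g x - g (x - r • σ)‖ ≤ m * ‖x - (x - r • σ)‖ :=
    convex_univ.norm_image_sub_le_of_norm_fderiv_le (fun z _ => hg z) (fun z _ => hgm z)
      (mem_univ _) (mem_univ _)
  rw [sub_sub_cancel, norm_smul, hσ, mul_one, Real.norm_of_nonneg hr.le] at hmvt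
  rwa [abs_div, abs_of_pos hr, div_le_iff₀ hr]

theorem fwdDiff_sub_fwdDiff_ray_le (hg : C2Bound g N) (hmax : ∀ z, Δ_[w] g z ≤ Δ_[w] g x)
    (hσ : ‖σ‖ = 1) : Δ_[w] g x - Δ_[w] g (x - δ • σ) ≤ 2 * N * δ ^ 2 := by
  have htaylor (z : Plane) : |g z - g (z - δ • σ) - fderiv ℝ g z (δ • σ)| ≤ N * δ ^ 2 :=
    (hg.abs_sub_sub_fderiv_le z (δ • σ)).trans_eq (by
      rw [norm_smul, hσ, mul_one, Real.norm_eq_abs, sq_abs])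
  have hadd := htaylor (x + w)
  rw [fderiv_add_eq_of_fwdDiff_le hg.differentiable hmax] at hadd
  rw [fwdDiff, fwdDiff, sub_add_eq_add_sub]
  linarith [(abs_le.1 hadd).2, (abs_le.1 (htaylor x)).1]

theorem integral_ray_contourIntegrand_sub_le (hα : α ∈ Ioo (-1) 1) (hε : 0 < ε)
    (hm : (5 + α + ε) * m ^ 2 ≤ 1 + α - ε) (hg : C2Bound g N) (hgm : ∀ x, ‖fderiv ℝ g x‖ ≤ m)
    (hmax : ∀ z, Δ_[w] g z ≤ Δ_[w] g x) (hδ : 0 < δ) (hδR : δ ≤ R) (hσ : ‖σ‖ = 1) :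
    ∫ r in δ..R, r * (contourIntegrand α g (x + w) (r • σ) - contourIntegrand α g x (r • σ)
        + ε / 8 * (‖r • σ‖ ^ (-3 - α) * (Δ_[w] g x - Δ_[w] g (x - r • σ))))
      ≤ 2 * N * δ ^ (1 - α) := by
  have hd := hg.differentiable
  have hderiv (z : Plane) : Continuous fun r : ℝ => fderiv ℝ g (z - r • σ) σ :=
    (hg.continuous_fderiv.comp (by fun_prop)).clm_apply continuous_const
  have hslope {r : ℝ} (hr : r ∈ Icc δ R) (z : Plane) :=
    _root_.abs_le.1 (abs_sub_ray_div_le hd hgm hσ (hδ.trans_le hr.1) z)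
  have hsplit (r : ℝ) : (g (x + w) - g (x + w - r • σ)) - (g x - g (x - r • σ))
      = Δ_[w] g x - Δ_[w] g (x - r • σ) := by
    rw [fwdDiff, fwdDiff, sub_add_eq_add_sub]
    ring
  have ha : |fderiv ℝ g x σ| ≤ m :=
    ((fderiv ℝ g x).le_of_opNorm_le (hgm x) σ).trans_eq (by rw [hσ, mul_one])
  have hray := integral_ray_sub_le (a := fderiv ℝ g x σ) hα hε hm ha hδ hδR
    (fun r _ => hasDerivAt_sub_ray hd x σ r) (fun r _ => hasDerivAt_sub_ray hd (x + w) σ r)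
    (hderiv x).continuousOn (hderiv (x + w)).continuousOn
    (fun r _ => sub_nonneg.1 (hsplit r ▸ sub_nonneg.2 (hmax _)))
    (fun r hr => (hslope hr x).1) (fun r hr => (hslope hr (x + w)).2)
  calc _ = _ := intervalIntegral.integral_congr fun r hr => ?_
    _ ≤ δ ^ (-1 - α) * (Δ_[w] g x - Δ_[w] g (x - δ • σ)) := hsplit δ ▸ hray
    _ ≤ δ ^ (-1 - α) * (2 * N * δ ^ 2) := mul_le_mul_of_nonneg_left
        (fwdDiff_sub_fwdDiff_ray_le hg hmax hσ) (Real.rpow_nonneg hδ.le _)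
    _ = 2 * N * δ ^ (1 - α) := by
        rw [show 1 - α = -1 - α + 1 + 1 by ring, Real.rpow_add_one hδ.ne',
          Real.rpow_add_one hδ.ne']
        ring
  have hr0 : 0 < r := hδ.trans_le (uIcc_of_le hδR ▸ hr).1
  have hadd := mul_contourIntegrand_smul (α := α) hσ hr0 g (x + w)
  rw [fderiv_add_eq_of_fwdDiff_le hd hmax] at hadd
  rw [mul_add, mul_sub, hadd, mul_contourIntegrand_smul hσ hr0,
    mul_left_comm r (ε / 8), mul_norm_smul_rpow_mul hσ hr0, ← hsplit]
  ring

theorem setIntegral_contourIntegrand_sub_le (hα : α ∈ Ioo (-1) 1) (hε : 0 < ε)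
    (hm : (5 + α + ε) * m ^ 2 ≤ 1 + α - ε) (hg : C2Bound g N) (hgm : ∀ x, ‖fderiv ℝ g x‖ ≤ m)
    (hmax : ∀ z, Δ_[w] g z ≤ Δ_[w] g x) (hδ : 0 < δ) (hδR : δ ≤ R)
    (hint_add : IntegrableOn (contourIntegrand α g (x + w)) (annulus Plane δ R))
    (hint : IntegrableOn (contourIntegrand α g x) (annulus Plane δ R)) :
    (∫ y in annulus Plane δ R, contourIntegrand α g (x + w) y)
        - ∫ y in annulus Plane δ R, contourIntegrand α g x y
      ≤ (volume : Measure Plane).toSphere.real univ * (2 * N * δ ^ (1 - α))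
        - ε / 8 * ∫ y in annulus Plane δ R, ‖y‖ ^ (-3 - α) * (Δ_[w] g x - Δ_[w] g (x - y)) := by
  have hcont : Continuous fun y => Δ_[w] g x - Δ_[w] g (x - y) := by
    have := hg.differentiable.continuous
    unfold fwdDiff
    fun_prop
  have hdiss := (integrableOn_annulus_rpow_mul volume R hδ (-3 - α) hcont).const_mul (ε / 8)
  have hdiff : IntegrableOn
      (fun y => contourIntegrand α g (x + w) y - contourIntegrand α g x y) (annulus Plane δ R) :=
    hint_add.sub hint
  have hpolar := setIntegral_annulus_le hδ.le hδR (hdiff.add hdiss) fun σ hσ => by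
    simpa using integral_ray_contourIntegrand_sub_le hα hε hm hg hgm hmax hδ hδR hσ
  simp only [Pi.add_apply] at hpolar
  rw [integral_add hdiff hdiss, integral_sub hint_add hint, integral_const_mul] at hpolar
  linarith

theorem principalValue_sub_le (hα : α ∈ Ioo (-1) 1) (hε : 0 < ε)
    (hm : (5 + α + ε) * m ^ 2 ≤ 1 + α - ε) (hg : C2Bound g N) (hgm : ∀ x, ‖fderiv ℝ g x‖ ≤ m)
    (hM : 0 ≤ M) (hL1 : eLpNorm (fderiv ℝ g) 1 ≤ ENNReal.ofReal M)
    (hmax : ∀ z, Δ_[w] g z ≤ Δ_[w] g x) (hv₁ : HasPrincipalValue (contourIntegrand α g (x + w)) v₁)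
    (hv₂ : HasPrincipalValue (contourIntegrand α g x) v₂) (hR : 0 < R) :
    v₁ - v₂ ≤ -(ε / 8 * (R ^ (-3 - α) * (Δ_[w] g x * (Real.pi * R ^ 2) - ‖w‖ * M))) := by
  have hg1 : ContDiff ℝ 1 g := hg.contDiff.of_le one_le_two
  have hcont : Continuous (Δ_[w] g) := (hg1.continuous.comp (by fun_prop)).sub hg1.continuous
  have htrunc : ∀ᶠ p : ℝ × ℝ in 𝓝[>] 0 ×ˢ atTop,
      (∫ y in annulus Plane p.1 p.2, contourIntegrand α g (x + w) y)
        - ∫ y in annulus Plane p.1 p.2, contourIntegrand α g x y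
      ≤ (volume : Measure Plane).toSphere.real univ * (2 * N * p.1 ^ (1 - α)) - ε / 8 *
        (R ^ (-3 - α) * (Δ_[w] g x * (Real.pi * (R ^ 2 - p.1 ^ 2)) - ‖w‖ * M)) := by
    have hδ : ∀ᶠ δ in 𝓝[>] (0 : ℝ), δ ∈ Ioo 0 R := Ioo_mem_nhdsGT hR
    filter_upwards [hδ.prod_mk (eventually_ge_atTop R)] with p hp
    obtain ⟨⟨hδ, hδR⟩, hRp⟩ := hp
    exact (setIntegral_contourIntegrand_sub_le hα hε hm hg hgm hmax hδ (hδR.le.trans hRp)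
      (hv₁.1 _ _ hδ) (hv₂.1 _ _ hδ)).trans <| sub_le_sub_left (mul_le_mul_of_nonneg_left
        (le_setIntegral_annulus_rpow_mul_sub (by linarith [hα.1]) hcont
          (integrable_fwdDiff hg1 hL1 w) (integral_abs_fwdDiff_le hg1 hM hL1 w) hmax hδ hδR hRp)
        (by positivity)) _
  have hfst : Tendsto (fun p : ℝ × ℝ => p.1) (𝓝[>] 0 ×ˢ atTop) (𝓝 0) :=
    (tendsto_nhds_of_tendsto_nhdsWithin tendsto_id).comp tendsto_fst
  have hbound : Continuous fun δ : ℝ =>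
      (volume : Measure Plane).toSphere.real univ * (2 * N * δ ^ (1 - α)) - ε / 8 *
        (R ^ (-3 - α) * (Δ_[w] g x * (Real.pi * (R ^ 2 - δ ^ 2)) - ‖w‖ * M)) := by
    have := Real.continuous_rpow_const (q := 1 - α) (by linarith [hα.2])
    fun_prop
  refine (le_of_tendsto_of_tendsto (hv₁.2.sub hv₂.2) ((hbound.tendsto 0).comp hfst) htrunc).trans_eq
    ?_
  rw [Real.zero_rpow (by linarith [hα.2])]
  ring

/-- The coefficient `c` in the differential inequality `S' ≤ -c S^{(3+α)/2}` satisfied by the slope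
`S`, when the gradient has `L¹` norm at most `M`. -/
noncomputable def decayRate (α ε M : ℝ) : ℝ := ε / 8 * M * (Real.pi / (2 * M)) ^ ((3 + α) / 2)

theorem decayRate_pos (hε : 0 < ε) (hM : 0 < M) : 0 < decayRate α ε M := by
  unfold decayRate
  positivity

theorem principalValue_sub_le_neg_decayRate (hα : α ∈ Ioo (-1) 1) (hε : 0 < ε)
    (hm : (5 + α + ε) * m ^ 2 ≤ 1 + α - ε) (hg : C2Bound g N) (hgm : ∀ x, ‖fderiv ℝ g x‖ ≤ m)
    (hM : 0 < M) (hL1 : eLpNorm (fderiv ℝ g) 1 ≤ ENNReal.ofReal M) (hw : w ≠ 0)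
    (hmax : ∀ z, Δ_[w] g z ≤ Δ_[w] g x) (hpos : 0 < Δ_[w] g x)
    (hv₁ : HasPrincipalValue (contourIntegrand α g (x + w)) v₁)
    (hv₂ : HasPrincipalValue (contourIntegrand α g x) v₂) :
    v₁ - v₂ ≤ -(‖w‖ * (decayRate α ε M * (Δ_[w] g x / ‖w‖) ^ ((3 + α) / 2))) := by
  have hw0 : 0 < ‖w‖ := norm_pos_iff.2 hw
  set S := Δ_[w] g x / ‖w‖ with hS
  have hS0 : 0 < S := div_pos hpos hw0
  have hD : Δ_[w] g x = ‖w‖ * S := by rw [hS, mul_div_cancel₀ _ hw0.ne']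
  have hb : 0 < Real.pi / (2 * M) * S := by positivity
  -- With this radius the disc term is twice the `L¹` term.
  have hv := principalValue_sub_le hα hε hm hg hgm hM.le hL1 hmax hv₁ hv₂
    (R := (Real.pi / (2 * M) * S) ^ (-(1 / 2) : ℝ)) (by positivity)
  have hsq : ((Real.pi / (2 * M) * S) ^ (-(1 / 2) : ℝ)) ^ 2 = (Real.pi / (2 * M) * S)⁻¹ := by
    rw [← Real.rpow_natCast, ← Real.rpow_mul hb.le, ← Real.rpow_neg_one]
    norm_num
  have hrpow : ((Real.pi / (2 * M) * S) ^ (-(1 / 2) : ℝ)) ^ (-3 - α)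
      = (Real.pi / (2 * M)) ^ ((3 + α) / 2) * S ^ ((3 + α) / 2) := by
    rw [← Real.rpow_mul hb.le, ← Real.mul_rpow (by positivity) hS0.le]
    ring_nf
  have hdisc : ‖w‖ * S * (Real.pi * (Real.pi / (2 * M) * S)⁻¹) - ‖w‖ * M = ‖w‖ * M := by
    field_simp
    ring
  rw [hsq, hrpow, hD, hdisc] at hv
  refine hv.trans_eq ?_
  rw [decayRate]
  ring

end Velocity

section Comparison

theorem continuousWithinAt_iSup {X : Type*} [Nonempty X] {F : ℝ → X → ℝ} {I : Set ℝ} {K t : ℝ}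
    (ht : t ∈ I) (hF : ∀ s ∈ I, BddAbove (range (F s)))
    (hK : ∀ᶠ s in 𝓝[I] t, ∀ x, |F s x - F t x| ≤ |s - t| * K) :
    ContinuousWithinAt (fun s => ⨆ x, F s x) I t := by
  have hlim : Tendsto (fun s => |s - t| * K) (𝓝[I] t) (𝓝 0) := by
    have hcont : Continuous fun s : ℝ => |s - t| * K := by fun_prop
    simpa using (hcont.tendsto t).mono_left nhdsWithin_le_nhds
  refine tendsto_iff_dist_tendsto_zero.2
    (squeeze_zero' (Eventually.of_forall fun _ => dist_nonneg) ?_ hlim)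
  filter_upwards [hK, self_mem_nhdsWithin] with s hs hsI
  have hle (x : X) := _root_.abs_le.1 (hs x)
  rw [Real.dist_eq, abs_sub_le_iff, sub_le_iff_le_add, sub_le_iff_le_add]
  exact ⟨ciSup_le fun x => by linarith [(hle x).2, le_ciSup (hF t ht) x],
    ciSup_le fun x => by linarith [(hle x).1, le_ciSup (hF s hsI) x]⟩

theorem forall_le_of_deriv_neg_at_max {X : Type*} [Nonempty X] {F : ℝ → X → ℝ} {B : ℝ → ℝ} {T : ℝ}
    (hbdd : ∀ t ∈ Icc 0 T, BddAbove (range (F t)))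
    (hF : ContinuousOn (fun t => ⨆ x, F t x) (Icc 0 T)) (hB : ContinuousOn B (Icc 0 T))
    (h0 : ∀ x, F 0 x ≤ B 0)
    (hmax : ∀ t ∈ Icc 0 T, ∀ x, B t < F t x → ∃ y, (∀ z, F t z ≤ F t y) ∧
      ∃ d < 0, HasDerivWithinAt (fun s => F s y - B s) d (Icc 0 T) t) :
    ∀ t ∈ Icc 0 T, ∀ x, F t x ≤ B t := by
  by_contra! ⟨t, ht, x, hgap⟩
  obtain ⟨t₁, ht₁, htmax⟩ := isCompact_Icc.exists_isMaxOn ⟨t, ht⟩ (hF.sub hB)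
  have hgap₁ : B t₁ < ⨆ z, F t₁ z := by
    have hle : (⨆ z, F t z) - B t ≤ (⨆ z, F t₁ z) - B t₁ := htmax ht
    linarith [le_ciSup (hbdd t ht) x]
  obtain ⟨x₁, hx₁⟩ := exists_lt_of_lt_ciSup hgap₁
  obtain ⟨y, hy, d, hd, hFd⟩ := hmax t₁ ht₁ x₁ hx₁
  have hymax : IsMaxOn (fun s => F s y - B s) (Icc 0 T) t₁ := fun s hs =>
    calc F s y - B s ≤ (⨆ z, F s z) - B s := sub_le_sub_right (le_ciSup (hbdd s hs) y) _
      _ ≤ (⨆ z, F t₁ z) - B t₁ := htmax hs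
      _ ≤ F t₁ y - B t₁ := sub_le_sub_right (ciSup_le hy) _
  have ht₁0 : 0 < t₁ := ht₁.1.lt_of_ne fun h => (h ▸ hx₁).not_ge (h0 x₁)
  have hd0 := hymax.localize.hasFDerivWithinAt_nonpos hFd.hasFDerivWithinAt
    (sub_mem_posTangentConeAt_of_segment_subset ((convex_Icc 0 T).segment_subset ht₁
      (left_mem_Icc.2 (ht₁.1.trans ht₁.2))))
  simp only [ContinuousLinearMap.toSpanSingleton_apply, smul_eq_mul] at hd0
  nlinarith

theorem forall_lt_of_forall_le_imp_lt {S : ℝ → ℝ} {m T : ℝ} (hS : ContinuousOn S (Icc 0 T))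
    (h0 : S 0 < m) (h : ∀ t ∈ Icc 0 T, (∀ s ∈ Icc 0 t, S s ≤ m) → S t < m) :
    ∀ t ∈ Icc 0 T, S t < m := by
  by_contra! ⟨t, ht, hmt⟩
  have hivt {s : ℝ} (hs : s ∈ Icc 0 T) (hms : m ≤ S s) : ∃ r ∈ Icc 0 s, S r = m :=
    intermediate_value_Icc hs.1 (hS.mono (Icc_subset_Icc_right hs.2)) ⟨h0.le, hms⟩
  have hcompact : IsCompact (Icc 0 T ∩ S ⁻¹' {m}) := isCompact_Icc.of_isClosed_subset
    (hS.preimage_isClosed_of_isClosed isClosed_Icc isClosed_singleton) inter_subset_left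
  obtain ⟨r, hr, hrm⟩ := hivt ht hmt
  obtain ⟨t₁, ⟨ht₁, ht₁m⟩, hleast⟩ := hcompact.exists_isLeast ⟨r, ⟨hr.1, hr.2.trans ht.2⟩, hrm⟩
  refine (h t₁ ht₁ fun s hs => ?_).ne ht₁m
  by_contra! hms
  have hsT : s ∈ Icc 0 T := ⟨hs.1, hs.2.trans ht₁.2⟩
  obtain ⟨r, hr, hrm⟩ := hivt hsT hms.le
  have hrs : t₁ ≤ r := hleast ⟨⟨hr.1, hr.2.trans hsT.2⟩, hrm⟩
  rw [hs.2.antisymm (hrs.trans hr.2)] at hms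
  exact hms.ne' ht₁m

end Comparison

section Barrier

/-- The solution of `B' = -c B^{1+p}` with `B(0) = L`. -/
noncomputable def decayBarrier (p c L t : ℝ) : ℝ := L / (1 + p * c * L ^ p * t) ^ p⁻¹

variable {p c L t : ℝ}

theorem decayBarrier_zero_right : decayBarrier p c L 0 = L := by simp [decayBarrier]

theorem one_le_decayBarrier_base (hp : 0 < p) (hc : 0 ≤ c) (hL : 0 ≤ L) (ht : 0 ≤ t) :
    1 ≤ 1 + p * c * L ^ p * t :=
  le_add_of_nonneg_right (by positivity)

theorem decayBarrier_nonneg (hp : 0 < p) (hc : 0 ≤ c) (hL : 0 ≤ L) (ht : 0 ≤ t) :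
    0 ≤ decayBarrier p c L t :=
  div_nonneg hL (Real.rpow_nonneg (zero_le_one.trans (one_le_decayBarrier_base hp hc hL ht)) _)

theorem decayBarrier_le (hp : 0 < p) (hc : 0 ≤ c) (hL : 0 ≤ L) (ht : 0 ≤ t) :
    decayBarrier p c L t ≤ L :=
  div_le_self hL (Real.one_le_rpow (one_le_decayBarrier_base hp hc hL ht) (by positivity))

theorem hasDerivAt_decayBarrier (hp : 0 < p) (hc : 0 ≤ c) (hL : 0 ≤ L) (ht : 0 ≤ t) :
    HasDerivAt (decayBarrier p c L) (-(c * decayBarrier p c L t ^ (1 + p))) t := by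
  rcases hL.eq_or_lt with rfl | hL
  · have hzero : decayBarrier p c 0 = fun _ => 0 := funext fun _ => zero_div _
    simpa [hzero, Real.zero_rpow (by positivity : 1 + p ≠ 0)] using hasDerivAt_const t (0 : ℝ)
  have hbase := zero_lt_one.trans_le (one_le_decayBarrier_base hp hc hL.le ht)
  set A := p * c * L ^ p with hA
  have hlin : HasDerivAt (fun s : ℝ => 1 + A * s) A t := by
    simpa using ((hasDerivAt_id t).const_mul A).const_add 1
  have hpow := (hlin.rpow_const (p := -p⁻¹) (Or.inl hbase.ne')).const_mul L
  have hev : decayBarrier p c L =ᶠ[𝓝 t] fun s => L * (1 + A * s) ^ (-p⁻¹) := by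
    filter_upwards [hlin.continuousAt.eventually (lt_mem_nhds hbase)] with s hs
    rw [decayBarrier, Real.rpow_neg hs.le, div_eq_mul_inv]
  refine (hpow.congr_of_eventuallyEq hev).congr_deriv ?_
  rw [hev.self_of_nhds, Real.mul_rpow hL.le (by positivity), ← Real.rpow_mul hbase.le,
    show -p⁻¹ * (1 + p) = -p⁻¹ - 1 by field_simp; ring, Real.rpow_add hL, Real.rpow_one, hA]
  field_simp

end Barrier

theorem fwdDiff_le_norm_mul {E : Type*} [NormedAddCommGroup E] [NormedSpace ℝ E] {g : E → ℝ}
    {L : ℝ} {w : E} (hg : Differentiable ℝ g) (hL : ∀ x, ‖fderiv ℝ g x‖ ≤ L) (x : E) :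
    Δ_[w] g x ≤ ‖w‖ * L := by
  have hmvt := convex_univ.norm_image_sub_le_of_norm_fderiv_le
    (fun y _ => hg y) (fun y _ => hL y) (mem_univ x) (mem_univ (x + w))
  rw [add_sub_cancel_left, mul_comm] at hmvt
  exact (le_abs_self _).trans hmvt

namespace IsSolution

variable {k : ℕ} {α ε m L M T τ : ℝ} {f₀ : Plane → ℝ} {f : ℝ → Plane → ℝ} {w : Plane} {t : ℝ}

theorem restrict (hf : IsSolution k α T f₀ f) (hτ : τ ≤ T) : IsSolution k α τ f₀ f := by
  have hsub : Icc 0 τ ⊆ Icc 0 T := Icc_subset_Icc_right hτ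
  obtain ⟨hH, f', hf', hlim, hcont⟩ := hf.isC1Curve
  exact
    { isC1Curve := ⟨fun t ht => hH t (hsub ht), f', fun t ht => hf' t (hsub ht),
        fun t ht => (hlim t (hsub ht)).mono_left (nhdsWithin_mono t (sdiff_subset_sdiff_left hsub)),
        fun t ht => (hcont t (hsub ht)).mono_left (nhdsWithin_mono t hsub)⟩
      continuous := fun t ht => hf.continuous t (hsub ht)
      equation := fun t ht x =>
        let ⟨v, hv, hderiv⟩ := hf.equation t (hsub ht) x
        ⟨v, hv, hderiv.mono hsub⟩
      initial := hf.initial }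

theorem exists_c2Bound (hk : 4 ≤ k) (hf : IsSolution k α T f₀ f) (ht : t ∈ Icc 0 T) :
    ∃ N, C2Bound (f t) N :=
  ⟨_, (hf.isC1Curve.1 t ht).c2Bound hk (hf.continuous t ht)⟩

theorem bddAbove_range_fwdDiff (hk : 4 ≤ k) (hf : IsSolution k α T f₀ f) (w : Plane)
    (ht : t ∈ Icc 0 T) : BddAbove (range (Δ_[w] (f t))) := by
  obtain ⟨N, hN⟩ := hf.exists_c2Bound hk ht
  refine ⟨N + N, forall_mem_range.2 fun x => (le_abs_self _).trans ?_⟩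
  exact (abs_sub _ _).trans (add_le_add (hN.abs_le (x + w)) (hN.abs_le x))

theorem continuousOn_iSup_fwdDiff (hk : 4 ≤ k) (hf : IsSolution k α T f₀ f) (w : Plane) :
    ContinuousOn (fun t => ⨆ x, Δ_[w] (f t) x) (Icc 0 T) := by
  intro t ht
  obtain ⟨K, hK⟩ := hf.isC1Curve.exists_eventually_c2Bound_sub hk hf.continuous ht
  refine continuousWithinAt_iSup (K := 2 * K) ht
    (fun s hs => hf.bddAbove_range_fwdDiff hk w hs) (hK.mono fun s hs x => ?_)
  calc |Δ_[w] (f s) x - Δ_[w] (f t) x|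
      = |(f s (x + w) - f t (x + w)) - (f s x - f t x)| := by
        rw [fwdDiff, fwdDiff, sub_sub_sub_comm]
    _ ≤ |f s (x + w) - f t (x + w)| + |f s x - f t x| := abs_sub _ _
    _ ≤ |s - t| * K + |s - t| * K := add_le_add (hs.abs_le (x + w)) (hs.abs_le x)
    _ = |s - t| * (2 * K) := by ring

theorem bddAbove_range_norm_fderiv (hk : 4 ≤ k) (hf : IsSolution k α T f₀ f) (ht : t ∈ Icc 0 T) :
    BddAbove (range fun x => ‖fderiv ℝ (f t) x‖) :=
  let ⟨N, hN⟩ := hf.exists_c2Bound hk ht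
  ⟨N, forall_mem_range.2 hN.norm_fderiv_le⟩

theorem continuousOn_iSup_norm_fderiv (hk : 4 ≤ k) (hf : IsSolution k α T f₀ f) :
    ContinuousOn (fun t => ⨆ x, ‖fderiv ℝ (f t) x‖) (Icc 0 T) := by
  intro t ht
  obtain ⟨K, hK⟩ := hf.isC1Curve.exists_eventually_c2Bound_sub hk hf.continuous ht
  obtain ⟨N, hN⟩ := hf.exists_c2Bound hk ht
  refine continuousWithinAt_iSup (K := K) ht (fun s hs => hf.bddAbove_range_norm_fderiv hk hs) ?_
  filter_upwards [hK, self_mem_nhdsWithin] with s hs hsT x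
  obtain ⟨N', hN'⟩ := hf.exists_c2Bound hk hsT
  have hsub := hs.norm_fderiv_le x
  rw [fderiv_fun_sub (hN'.differentiable x) (hN.differentiable x)] at hsub
  exact (abs_norm_sub_norm_le _ _).trans hsub

theorem exists_forall_fwdDiff_le (hk : 4 ≤ k) (hf : IsSolution k α T f₀ f) (ht : t ∈ Icc 0 T)
    {x : Plane} (hx : 0 < Δ_[w] (f t) x) : ∃ y, ∀ z, Δ_[w] (f t) z ≤ Δ_[w] (f t) y := by
  have hcont : Continuous (Δ_[w] (f t)) :=
    ((hf.continuous t ht).comp (by fun_prop)).sub (hf.continuous t ht)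
  have hzero := (hf.isC1Curve.1 t ht).tendsto_cocompact hk (hf.continuous t ht)
  have hlim : Tendsto (Δ_[w] (f t)) (cocompact Plane) (𝓝 0) := by
    have hshift := hzero.comp (Homeomorph.addRight w).isClosedEmbedding.tendsto_cocompact
    exact sub_zero (0 : ℝ) ▸ hshift.sub hzero
  exact hcont.exists_forall_ge' x ((hlim.eventually (gt_mem_nhds hx)).mono fun _ h => h.le)

theorem exists_hasDerivWithinAt_fwdDiff (hk : 4 ≤ k) (hf : IsSolution k α T f₀ f)
    (hα : α ∈ Ioo (-1) 1) (hε : 0 < ε) (hm : (5 + α + ε) * m ^ 2 ≤ 1 + α - ε) (hM : 0 < M)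
    (ht : t ∈ Icc 0 T) (hL1 : eLpNorm (fderiv ℝ (f t)) 1 ≤ ENNReal.ofReal M)
    (hslope : ∀ x, ‖fderiv ℝ (f t) x‖ ≤ m) (hw : w ≠ 0) {x : Plane}
    (hmax : ∀ z, Δ_[w] (f t) z ≤ Δ_[w] (f t) x) (hpos : 0 < Δ_[w] (f t) x) :
    ∃ v ≤ -(‖w‖ * (decayRate α ε M * (Δ_[w] (f t) x / ‖w‖) ^ ((3 + α) / 2))),
      HasDerivWithinAt (fun s => Δ_[w] (f s) x) v (Icc 0 T) t := by
  obtain ⟨N, hN⟩ := hf.exists_c2Bound hk ht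
  obtain ⟨v₁, hv₁, hderiv₁⟩ := hf.equation t ht (x + w)
  obtain ⟨v₂, hv₂, hderiv₂⟩ := hf.equation t ht x
  exact ⟨v₁ - v₂,
    principalValue_sub_le_neg_decayRate hα hε hm hN hslope hM hL1 hw hmax hpos hv₁ hv₂,
    hderiv₁.sub hderiv₂⟩

theorem fwdDiff_le_norm_mul_decayBarrier (hk : 4 ≤ k) (hf : IsSolution k α T f₀ f)
    (hα : α ∈ Ioo (-1) 1) (hε : 0 < ε) (hm : (5 + α + ε) * m ^ 2 ≤ 1 + α - ε) (hM : 0 < M)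
    (hL1 : ∀ t ∈ Icc 0 T, eLpNorm (fderiv ℝ (f t)) 1 ≤ ENNReal.ofReal M)
    (hslope : ∀ t ∈ Icc 0 T, ∀ x, ‖fderiv ℝ (f t) x‖ ≤ m) (hL : 0 ≤ L)
    (h0 : ∀ x, ‖fderiv ℝ f₀ x‖ ≤ L) (hw : w ≠ 0) (ht : t ∈ Icc 0 T) (x : Plane) :
    Δ_[w] (f t) x ≤ ‖w‖ * decayBarrier ((1 + α) / 2) (decayRate α ε M) L t := by
  have hp : 0 < (1 + α) / 2 := by linarith [hα.1]
  have hc := decayRate_pos (α := α) hε hM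
  have hw0 : 0 < ‖w‖ := norm_pos_iff.2 hw
  set B := decayBarrier ((1 + α) / 2) (decayRate α ε M) L
  have hB (s : ℝ) (hs : s ∈ Icc 0 T) : HasDerivAt (fun s => ‖w‖ * B s)
      (‖w‖ * -(decayRate α ε M * B s ^ (1 + (1 + α) / 2))) s :=
    (hasDerivAt_decayBarrier hp hc.le hL hs.1).const_mul ‖w‖
  refine forall_le_of_deriv_neg_at_max (fun s hs => hf.bddAbove_range_fwdDiff hk w hs)
    (hf.continuousOn_iSup_fwdDiff hk w)
    (fun s hs => (hB s hs).continuousAt.continuousWithinAt) (fun z => ?_)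
    (fun s hs z hz => ?_) t ht x
  · obtain ⟨N, hN⟩ := hf.exists_c2Bound hk (left_mem_Icc.2 (ht.1.trans ht.2))
    exact (fwdDiff_le_norm_mul hN.differentiable (hf.initial ▸ h0) z).trans_eq
      (congrArg (‖w‖ * ·) decayBarrier_zero_right.symm)
  · have hBs : 0 ≤ B s := decayBarrier_nonneg hp hc.le hL hs.1
    have hz0 : 0 < Δ_[w] (f s) z := (mul_nonneg hw0.le hBs).trans_lt hz
    obtain ⟨y, hy⟩ := hf.exists_forall_fwdDiff_le hk hs hz0
    obtain ⟨v, hv, hderiv⟩ := hf.exists_hasDerivWithinAt_fwdDiff hk hα hε hm hM hs (hL1 s hs)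
      (hslope s hs) hw hy (hz0.trans_le (hy z))
    refine ⟨y, hy, _, ?_, hderiv.sub (hB s hs).hasDerivWithinAt⟩
    have hpow : B s ^ (1 + (1 + α) / 2) < (Δ_[w] (f s) y / ‖w‖) ^ ((3 + α) / 2) := by
      rw [show 1 + (1 + α) / 2 = (3 + α) / 2 by ring]
      exact Real.rpow_lt_rpow hBs ((lt_div_iff₀' hw0).2 (hz.trans_le (hy z)))
        (by linarith [hα.1])
    linarith [mul_lt_mul_of_pos_left (mul_lt_mul_of_pos_left hpow hc) hw0]

theorem norm_fderiv_le_decayBarrier_of_forall_le (hk : 4 ≤ k) (hf : IsSolution k α T f₀ f)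
    (hα : α ∈ Ioo (-1) 1) (hε : 0 < ε) (hm : (5 + α + ε) * m ^ 2 ≤ 1 + α - ε) (hM : 0 < M)
    (hL1 : ∀ t ∈ Icc 0 T, eLpNorm (fderiv ℝ (f t)) 1 ≤ ENNReal.ofReal M)
    (hslope : ∀ t ∈ Icc 0 T, ∀ x, ‖fderiv ℝ (f t) x‖ ≤ m) (hL : 0 ≤ L)
    (h0 : ∀ x, ‖fderiv ℝ f₀ x‖ ≤ L) (ht : t ∈ Icc 0 T) (x : Plane) :
    ‖fderiv ℝ (f t) x‖ ≤ decayBarrier ((1 + α) / 2) (decayRate α ε M) L t := by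
  have hB := decayBarrier_nonneg (by linarith [hα.1] : 0 < (1 + α) / 2)
    (decayRate_pos (α := α) hε hM).le hL ht.1
  have hle (y z : Plane) :
      f t z - f t y ≤ decayBarrier ((1 + α) / 2) (decayRate α ε M) L t * ‖z - y‖ := by
    rcases eq_or_ne z y with rfl | hzy
    · simp
    have hdiff := hf.fwdDiff_le_norm_mul_decayBarrier hk hα hε hm hM hL1 hslope hL h0
      (sub_ne_zero.2 hzy) ht y
    rwa [fwdDiff, add_sub_cancel, mul_comm] at hdiff
  refine norm_fderiv_le_of_lip' ℝ hB (Eventually.of_forall fun y => abs_sub_le_iff.2 ⟨hle x y, ?_⟩)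
  rw [norm_sub_rev]
  exact hle y x

theorem norm_fderiv_le_decayBarrier (hk : 4 ≤ k) (hf : IsSolution k α T f₀ f)
    (hα : α ∈ Ioo (-1) 1) (hε : 0 < ε) (hm : (5 + α + ε) * m ^ 2 ≤ 1 + α - ε) (hM : 0 < M)
    (hL1 : ∀ t ∈ Icc 0 T, eLpNorm (fderiv ℝ (f t)) 1 ≤ ENNReal.ofReal M) (hL : 0 ≤ L)
    (hLm : L < m) (h0 : ∀ x, ‖fderiv ℝ f₀ x‖ ≤ L) (ht : t ∈ Icc 0 T) (x : Plane) :
    ‖fderiv ℝ (f t) x‖ ≤ decayBarrier ((1 + α) / 2) (decayRate α ε M) L t := by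
  have hdecay {τ : ℝ} (hτ : τ ∈ Icc 0 T)
      (hslope : ∀ s ∈ Icc 0 τ, ⨆ z, ‖fderiv ℝ (f s) z‖ ≤ m) (z : Plane) :=
    (hf.restrict hτ.2).norm_fderiv_le_decayBarrier_of_forall_le hk hα hε hm hM
      (fun s hs => hL1 s (Icc_subset_Icc_right hτ.2 hs))
      (fun s hs y => (le_ciSup ((hf.restrict hτ.2).bddAbove_range_norm_fderiv hk hs) y).trans
        (hslope s hs)) hL h0 (right_mem_Icc.2 hτ.1) z
  have hthreshold : ∀ s ∈ Icc 0 T, ⨆ z, ‖fderiv ℝ (f s) z‖ < m := by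
    refine forall_lt_of_forall_le_imp_lt (hf.continuousOn_iSup_norm_fderiv hk) ?_ fun s hs hle =>
      (ciSup_le fun z => (hdecay hs hle z).trans ?_).trans_lt hLm
    · exact (ciSup_le (hf.initial ▸ h0)).trans_lt hLm
    · exact decayBarrier_le (by linarith [hα.1]) (decayRate_pos hε hM).le hL hs.1
  exact hdecay ht (fun s hs => (hthreshold s (Icc_subset_Icc_right ht.2 hs)).le) x

end IsSolution

theorem norm_le_toReal_eLpNorm_top {X E : Type*} [TopologicalSpace X] [MeasurableSpace X]
    [NormedAddCommGroup E] {μ : Measure X} [μ.IsOpenPosMeasure] {φ : X → E} (hφ : Continuous φ)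
    (htop : eLpNorm φ ∞ μ ≠ ∞) (x : X) : ‖φ x‖ ≤ (eLpNorm φ ∞ μ).toReal := by
  have hae : ∀ᵐ z ∂μ, ‖φ z‖ ≤ (eLpNorm φ ∞ μ).toReal := by
    filter_upwards [ae_le_eLpNormEssSup (f := φ) (μ := μ)] with z hz
    rw [← eLpNorm_exponent_top] at hz
    exact toReal_enorm (φ z) ▸ ENNReal.toReal_mono htop hz
  exact (isClosed_le hφ.norm continuous_const).closure_subset (Measure.dense_of_ae hae x)

theorem eLpNorm_gradient {E : Type*} [NormedAddCommGroup E] [InnerProductSpace ℝ E]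
    [CompleteSpace E] [MeasurableSpace E] (g : E → ℝ) (p : ℝ≥0∞) (μ : Measure E) :
    eLpNorm (∇ g) p μ = eLpNorm (fderiv ℝ g) p μ :=
  eLpNorm_congr_norm_ae (ae_of_all μ (norm_gradient_eq g))

theorem exists_pos_decayBarrier_eq (b M ε α : ℝ) :
    ∃ C > 0, 0 ≤ b → 0 < M → 0 < ε → -1 < α → ∀ t,
      decayBarrier ((1 + α) / 2) (decayRate α ε M) b t = b / (1 + C * t) ^ (2 / (1 + α)) := by
  by_cases h : 0 < b ∧ 0 < M ∧ 0 < ε ∧ -1 < α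
  · obtain ⟨hb, hM, hε, hα⟩ := h
    have hc := decayRate_pos (α := α) hε hM
    have hp : 0 < (1 + α) / 2 := by linarith
    exact ⟨(1 + α) / 2 * decayRate α ε M * b ^ ((1 + α) / 2), by positivity, fun _ _ _ _ t => by
      rw [decayBarrier, inv_div]⟩
  · refine ⟨1, one_pos, fun hb hM hε hα t => ?_⟩
    obtain rfl : b = 0 := hb.antisymm' (not_lt.1 fun hb => h ⟨hb, hM, hε, hα⟩)
    rw [decayBarrier, zero_div, zero_div]

theorem mul_sq_sqrt_div_eq {α ε : ℝ} (hε : ε ∈ Ioo 0 (1 + α)) :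
    (5 + α + ε) * √((1 + α - ε) / (5 + α + ε)) ^ 2 = 1 + α - ε := by
  have hden : 0 < 5 + α + ε := by linarith [hε.1, hε.2]
  rw [Real.sq_sqrt (div_nonneg (by linarith [hε.2]) hden.le), mul_div_cancel₀ _ hden.ne']

end AlphaMuskat

theorem mainTheorem6_general :
    ∃ C : ℝ → ℝ → ℝ → ℝ → ℝ,
      (∀ b M ε α : ℝ, 0 < C b M ε α) ∧
      ∀ (k : ℕ) (α ε T M : ℝ) (f₀ : AlphaMuskat.Plane → ℝ) (f : ℝ → AlphaMuskat.Plane → ℝ),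
        4 ≤ k → α < 1 → ε ∈ Ioo 0 (1 + α) → 0 < M →
        AlphaMuskat.IsSolution k α T f₀ f →
        eLpNorm (∇ f₀) ∞ volume
          < ENNReal.ofReal (Real.sqrt ((1 + α - ε) / (5 + α + ε))) →
        (∀ t ∈ Icc 0 T, eLpNorm (∇ (f t)) 1 volume ≤ ENNReal.ofReal M) →
        ∀ t ∈ Icc 0 T,
          eLpNorm (∇ (f t)) ∞ volume ≤
            eLpNorm (∇ f₀) ∞ volume /
              ENNReal.ofReal
                ((1 + C (eLpNorm (∇ f₀) ∞ volume).toReal M ε α * t) ^ (2 / (1 + α))) := by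
  choose C hC hbarrier using AlphaMuskat.exists_pos_decayBarrier_eq
  refine ⟨C, hC, fun k α ε T M f₀ f hk hα hε hM hf hsmall hL1 t ht => ?_⟩
  have hα' : α ∈ Ioo (-1) 1 := ⟨by linarith [hε.1, hε.2], hα⟩
  simp only [AlphaMuskat.eLpNorm_gradient] at hsmall hL1 ⊢
  have htop : eLpNorm (fderiv ℝ f₀) ∞ volume ≠ ∞ := hsmall.ne_top
  set b := (eLpNorm (fderiv ℝ f₀) ∞ volume).toReal
  obtain ⟨N, hN⟩ := hf.exists_c2Bound hk (left_mem_Icc.2 (ht.1.trans ht.2))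
  have hinit : ∀ x, ‖fderiv ℝ f₀ x‖ ≤ b :=
    AlphaMuskat.norm_le_toReal_eLpNorm_top (hf.initial ▸ hN.continuous_fderiv) htop
  have hdecay (x : AlphaMuskat.Plane) := hf.norm_fderiv_le_decayBarrier hk hα' hε.1
    (AlphaMuskat.mul_sq_sqrt_div_eq hε).le hM hL1 ENNReal.toReal_nonneg
    (ENNReal.toReal_lt_of_lt_ofReal hsmall) hinit ht x
  rw [hbarrier b M ε α ENNReal.toReal_nonneg hM hε.1 hα'.1 t] at hdecay
  have hpos : 0 < (1 + C b M ε α * t) ^ (2 / (1 + α)) :=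
    Real.rpow_pos_of_pos (by nlinarith [hC b M ε α, ht.1]) _
  rw [← ENNReal.ofReal_toReal htop, ← ENNReal.ofReal_div_of_pos hpos, eLpNorm_exponent_top]
  exact eLpNormEssSup_le_of_ae_bound (ae_of_all _ hdecay)

theorem mainTheorem6 :
    ∃ C : ℝ → ℝ → ℝ → ℝ → ℝ → ℝ,
      (∀ a b M ε α : ℝ, 0 < C a b M ε α) ∧
      ∀ (k : ℕ) (α ε T M : ℝ) (f₀ : AlphaMuskat.Plane → ℝ) (f : ℝ → AlphaMuskat.Plane → ℝ),
        4 ≤ k → α ∈ Ico (0 : ℝ) 1 → ε ∈ Ioo 0 (1 + α) → 0 < T → 0 < M →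
        AlphaMuskat.MemH k f₀ →
        AlphaMuskat.IsSolution k α T f₀ f →
        eLpNorm (∇ f₀) ∞ volume
          < ENNReal.ofReal (Real.sqrt ((1 + α - ε) / (5 + α + ε))) →
        (∀ t ∈ Icc 0 T, eLpNorm (∇ (f t)) 1 volume ≤ ENNReal.ofReal M) →
        ∀ t ∈ Icc 0 T,
          eLpNorm (∇ (f t)) ∞ volume ≤
            eLpNorm (∇ f₀) ∞ volume /
              ENNReal.ofReal
                ((1 + C (eLpNorm f₀ ∞ volume).toReal (eLpNorm (∇ f₀) ∞ volume).toReal M ε α * t)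
                  ^ (2 / (1 + α))) :=
  let ⟨C, hC, hdecay⟩ := mainTheorem6_general
  ⟨fun _ => C, fun _ => hC, fun k α ε T M f₀ f hk hα hε _ hM _ =>
    hdecay k α ε T M f₀ f hk hα.2 hε hM⟩
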